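/- Let $b\in\mathbb C$ with $\operatorname{Re} b>-1/2$ and consider on the unit circle $\mathbb T$ the modified Jacobi weight $$\nu(z)=(-z)^{-\overline b}(1-z)^{b+\overline b}\quad\text{(principal powers)},\qquad d\mu(z)=\frac{\nu(z)}{iz}\,dz .$$ There are a unique sequence of monic polynomials $\Phi_n$ with $\deg\Phi_n=n$ and unique numbers $\kappa_n>0$ ($n\ge 0$) such that $\int_{\mathbb T}\Phi_n\overline{\Phi_m}\,d\mu=\kappa_n^{-2}\delta_{n,m}$. Put $\Phi_n^*(z)=z^n\overline{\Phi_n(1/\overline z)}$, $\alpha_{n-1}=-\overline{\Phi_n(0)}$ (so $\alpha_{-1}=-1$), $b_n=2\pi\kappa_n^2$, let $\Phi_1^n$ be the coefficient of $z^{n-1}$ in $\Phi_n$, and for $|z|\neq 1$ let $$G_n(z)=\frac1{2\pi i}\int_{\mathbb T}\frac{\Phi_n(t)}{t-z}\frac{\nu(t)}{t^n}\,dt,\qquad G_{n-1}^*(z)=\frac1{2\pi i}\int_{\mathbb T}\frac{\Phi_{n-1}^*(t)}{t-z}\frac{\nu(t)}{t^n}\,dt,\qquad Y_n=\begin{bmatrix}\Phi_n&G_n\\-b_{n-1}\Phi_{n-1}^*&-b_{n-1}G_{n-1}^*\end{bmatrix}.$$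 Let $C_n(z)=\operatorname{diag}\big(z^{-n/2}\nu(z)^{1/2},\,z^{n/2}\nu(z)^{-1/2}\big)$, where $\nu(z)=(-z)^{-\overline b}(1-z)^{b+\overline b}$ and the square roots are any holomorphic branches on an open set $U\subset\mathbb C\setminus\mathbb T$ with $0\notin U$; let $Z_n=Y_nC_n$ and $M_n=Z_n'Z_n^{-1}$ on $U$. Then for every $n\ge 1$ the following hold. (i) $G_n$ and $G^*_{n-1}$ are holomorphic in $\mathbb C\setminus\mathbb T$, and $\det Y_n=1$ there. (ii) For every such $U$, every choice of branches and every $z\in U$, $$z(1-z)M_n(z)=\begin{bmatrix}-\frac{(b+n)z+(\overline b+n)(2|\alpha_{n-1}|^2-1)}2&-b_n^{-1}(\overline b+n)\overline{\alpha_{n-1}}\\-b_{n-1}(\overline b+n)\alpha_{n-1}&\frac{(b+n)z+(\overline b+n)(2|\alpha_{n-1}|^2-1)}2\end{bmatrix}$$ and also $$z(1-z)M_n(z)=\begin{bmatrix}-\frac{(b+n)z+(\overline b-n)}2+\Phi_1^n&-(b+n+1)b_n^{-1}\overline{\alpha_n}\\-(b+n-1)b_{n-1}\alpha_{n-2}&\frac{(b+n)z+(\overline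 b-n)}2-\Phi_1^n\end{bmatrix}.$$ (iii) $\displaystyle \Phi_1^n=\overline b-(\overline b+n)|\alpha_{n-1}|^2$ and $\displaystyle \alpha_n=\frac{b+n}{\overline b+n+1}\,\alpha_{n-1}$. (iv) For all $z\in\mathbb C$ in the relations for the polynomials, and all $z\in\mathbb C\setminus\mathbb T$ in those for $G_n$ and $G_{n-1}^*$, \begin{align*} z(1-z)\Phi_n'(z)&=\big(-nz+(\overline b+n)(1-|\alpha_{n-1}|^2)\big)\Phi_n(z)+(\overline b+n)(1-|\alpha_{n-1}|^2)\overline{\alpha_{n-1}}\,\Phi_{n-1}^*(z),\\ z(1-z)G_n'(z)&=\big(-bz-(\overline b+n)|\alpha_{n-1}|^2\big)G_n(z)+(\overline b+n)(1-|\alpha_{n-1}|^2)\overline{\alpha_{n-1}}\,G_{n-1}^*(z),\\ z(1-z)(\Phi_{n-1}^*)'(z)&=\big(bz+(\overline b+n)|\alpha_{n-1}|^2\big)\Phi_{n-1}^*(z)+(\overline b+n)\alpha_{n-1}\Phi_n(z),\\ z(1-z)(G_{n-1}^*)'(z)&=\big(nz-(\overline b+n)(1-|\alpha_{n-1}|^2)\big)G_{n-1}^*(z)+(\overline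 b+n)\alpha_{n-1}G_n(z),\\ (z-1)\Phi_n'(z)&=-(\overline b+n)(1-|\alpha_{n-1}|^2)\Phi_{n-1}(z)+n\Phi_n(z). \end{align*} -/

import Mathlib

noncomputable section

namespace JacobiOPUC

open Complex Polynomial ComplexConjugate

/-- The modified Jacobi weight `ν(z) = (-z)^{-b̄} (1-z)^{b+b̄}` on the unit circle (principal
powers). With `b = λ + iη` and `z = e^{iθ}`, `0 < θ < 2π`, it equals
`e^{η(π-θ)} (4 sin²(θ/2))^λ`. -/
def nu (b z : ℂ) : ℂ := (-z) ^ (-conj b) * (1 - z) ^ (b + conj b)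

/-- `∫_𝕋 p(z) conj(q(z)) dμ(z)` with `dμ(z) = ν(z) / (i z) dz`. -/
def pairing (b : ℂ) (p q : ℂ[X]) : ℂ :=
  ∮ z in C(0, 1), p.eval z * conj (q.eval z) * (nu b z / (I * z))

/-- `Φ` is the sequence of monic orthogonal polynomials of the weight, with
`∫ Φ_n conj(Φ_m) dμ = κ_n⁻² δ_{nm}`, `κ_n > 0`. -/
structure IsMonicOrthogonal (b : ℂ) (Φ : ℕ → ℂ[X]) (κ : ℕ → ℝ) : Prop where
  monic : ∀ n, (Φ n).Monic
  natDegree_eq : ∀ n, (Φ n).natDegree = n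
  kappa_pos : ∀ n, 0 < κ n
  orthogonal : ∀ n m, n ≠ m → pairing b (Φ n) (Φ m) = 0
  norm_sq : ∀ n, pairing b (Φ n) (Φ n) = (((κ n ^ 2)⁻¹ : ℝ) : ℂ)

/-- The reciprocal polynomial `Φ_n^*(z) = z^n conj(Φ_n(1 / conj z))`. -/
def recip (Φ : ℕ → ℂ[X]) (n : ℕ) : ℂ[X] := ((Φ n).map (starRingEnd ℂ)).reflect n

/-- The Verblunsky coefficients `α_k = -conj(Φ_{k+1}(0))`, `k ≥ -1` (so `α_{-1} = -1`). -/
def alpha (Φ : ℕ → ℂ[X]) (k : ℤ) : ℂ := -conj ((Φ (k + 1).toNat).eval 0)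

/-- The constants `b_n = 2π κ_n²`. -/
def bconst (κ : ℕ → ℝ) (n : ℕ) : ℂ := ((2 * Real.pi * κ n ^ 2 : ℝ) : ℂ)

/-- `G_n(z) = (1/2πi) ∫_𝕋 Φ_n(t)/(t-z) ν(t)/t^n dt`. -/
def G (b : ℂ) (Φ : ℕ → ℂ[X]) (n : ℕ) (z : ℂ) : ℂ :=
  (2 * Real.pi * I)⁻¹ * ∮ t in C(0, 1), (Φ n).eval t / (t - z) * (nu b t / t ^ n)

/-- `G_k^*(z) = (1/2πi) ∫_𝕋 Φ_k^*(t)/(t-z) ν(t)/t^{k+1} dt`. -/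
def Gstar (b : ℂ) (Φ : ℕ → ℂ[X]) (k : ℕ) (z : ℂ) : ℂ :=
  (2 * Real.pi * I)⁻¹ * ∮ t in C(0, 1), (recip Φ k).eval t / (t - z) * (nu b t / t ^ (k + 1))

/-- The matrix `Y_n` solving the Riemann-Hilbert problem (used for `n ≥ 1`). -/
def Y (b : ℂ) (Φ : ℕ → ℂ[X]) (κ : ℕ → ℝ) (n : ℕ) (z : ℂ) : Matrix (Fin 2) (Fin 2) ℂ :=
  !![(Φ n).eval z, G b Φ n z;
     -bconst κ (n - 1) * (recip Φ (n - 1)).eval z, -bconst κ (n - 1) * Gstar b Φ (n - 1) z]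

/-- A choice, on a set `U`, of holomorphic branches of the multivalued functions
`ν(z)^{1/2}` and `z^{n/2}`: here `logNeg` and `logOneSub` are logarithms of `-z` and `1 - z`,
and `ν(z) = exp(-b̄ log(-z) + (b+b̄) log(1-z))` is the corresponding branch of the weight. -/
structure Branch (b : ℂ) (n : ℕ) (U : Set ℂ) where
  logNeg : ℂ → ℂ
  logOneSub : ℂ → ℂ
  sqrtNu : ℂ → ℂ
  powHalf : ℂ → ℂ
  logNeg_holo : DifferentiableOn ℂ logNeg U
  logOneSub_holo : DifferentiableOn ℂ logOneSub U
  sqrtNu_holo : DifferentiableOn ℂ sqrtNu U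
  powHalf_holo : DifferentiableOn ℂ powHalf U
  exp_logNeg : ∀ z ∈ U, exp (logNeg z) = -z
  exp_logOneSub : ∀ z ∈ U, exp (logOneSub z) = 1 - z
  sqrtNu_sq : ∀ z ∈ U, sqrtNu z ^ 2 = exp (-conj b * logNeg z + (b + conj b) * logOneSub z)
  powHalf_sq : ∀ z ∈ U, powHalf z ^ 2 = z ^ n

/-- Branches exist near every point other than `0` and `1`. -/
theorem exists_branch (b : ℂ) (n : ℕ) (z₀ : ℂ) (h0 : z₀ ≠ 0) (h1 : z₀ ≠ 1) :
    ∃ U : Set ℂ, IsOpen U ∧ z₀ ∈ U ∧ Nonempty (Branch b n U) := by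
  have h1' : 1 - z₀ ≠ 0 := sub_ne_zero.mpr (Ne.symm h1)
  let U : Set ℂ := {z | z / z₀ ∈ slitPlane} ∩ {z | (1 - z) / (1 - z₀) ∈ slitPlane}
  let L : ℂ → ℂ := fun z => log (z / z₀) + log (-z₀)
  let K : ℂ → ℂ := fun z => log ((1 - z) / (1 - z₀)) + log (1 - z₀)
  have hL : DifferentiableOn ℂ L U := fun z hz =>
    ((DifferentiableAt.clog (f := fun z => z / z₀) (by fun_prop) hz.1).add_const _).differentiableWithinAt
  have hK : DifferentiableOn ℂ K U := fun z hz =>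
    ((DifferentiableAt.clog (f := fun z => (1 - z) / (1 - z₀)) (by fun_prop)
      hz.2).add_const _).differentiableWithinAt
  have eL : ∀ z ∈ U, exp (L z) = -z := by
    intro z hz
    simp only [L]
    rw [exp_add, exp_log (slitPlane_ne_zero hz.1), exp_log (neg_ne_zero.mpr h0)]
    field_simp
  have eK : ∀ z ∈ U, exp (K z) = 1 - z := by
    intro z hz
    simp only [K]
    rw [exp_add, exp_log (slitPlane_ne_zero hz.2), exp_log h1']
    field_simp
  refine ⟨U, ?_, ?_, ⟨⟨L, K, fun z => exp ((-conj b * L z + (b + conj b) * K z) / 2),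
    fun z => exp (n * (L z + Real.pi * I) / 2), hL, hK, ?_, ?_, eL, eK, ?_, ?_⟩⟩⟩
  · exact (isOpen_slitPlane.preimage (by fun_prop)).inter
      (isOpen_slitPlane.preimage (by fun_prop))
  · exact ⟨by simp [h0], by simp [h1']⟩
  · fun_prop
  · fun_prop
  · intro z _
    rw [← exp_nat_mul]
    congr 1
    push_cast
    ring
  · intro z hz
    rw [← exp_nat_mul]
    have : ((2 : ℕ) : ℂ) * (n * (L z + Real.pi * I) / 2) = n * (L z + Real.pi * I) := by
      push_cast
      ring
    rw [this, exp_nat_mul, exp_add, eL z hz, exp_pi_mul_I]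
    simp

/-- `C_n(z) = diag(z^{-n/2} ν(z)^{1/2}, z^{n/2} ν(z)^{-1/2})` for the given branches. -/
def Branch.C {b : ℂ} {n : ℕ} {U : Set ℂ} (β : Branch b n U) (z : ℂ) :
    Matrix (Fin 2) (Fin 2) ℂ :=
  !![β.sqrtNu z / β.powHalf z, 0; 0, β.powHalf z / β.sqrtNu z]

/-- The constant jump fundamental matrix `Z_n = Y_n C_n`. -/
def Z {b : ℂ} {n : ℕ} {U : Set ℂ} (β : Branch b n U) (Φ : ℕ → ℂ[X]) (κ : ℕ → ℝ) (z : ℂ) :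
    Matrix (Fin 2) (Fin 2) ℂ :=
  Y b Φ κ n z * β.C z

/-- The structure matrix `M_n = Z_n' Z_n⁻¹`, with `Z_n'` the entrywise derivative. -/
def M {b : ℂ} {n : ℕ} {U : Set ℂ} (β : Branch b n U) (Φ : ℕ → ℂ[X]) (κ : ℕ → ℝ) (z : ℂ) :
    Matrix (Fin 2) (Fin 2) ℂ :=
  (Matrix.of fun i j => deriv (fun w => Z β Φ κ w i j) z) * (Z β Φ κ z)⁻¹

end JacobiOPUC

end

/-! On the circle the weight is the positive density e^{η(π-θ)} (2 sin(θ/2))^{2λ}, with b = λ + iη,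
and it satisfies the Pearson equation z(1-z)ν' = -(b̄ + bz)ν. Since 2 Re b + 1 > 0, the factor
(1-t)ν(t) tends to 0 as t → 1 on the circle, so integration by parts has no boundary term
(`circleFunctional_deriv_eq_zero`). No Riemann-Hilbert or Liouville argument is needed; everything
follows from this formula and orthogonality.

For polynomials, the pairing is positive definite, so a polynomial orthogonal to every monomial
occurring in it is zero (`eq_zero_of_pairing_X_pow`). Each identity is the vanishing of such a
difference: the outer coefficients cancel, and the remaining pairings vanish by orthogonality or by
Pearson (`pairing_derivative`). This gives the Szegő recursion, the lowering relation for Φ_n and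
the structure relation for Φ*_{n-1}. Comparing coefficients yields Φ_1^n and the recursion for α_n.

For G_n and G*_{n-1}, the same integration by parts with the kernel 1/(t-z) expresses the derivative
of a Cauchy transform through the transform of (1-X)X p' (`mul_deriv_cauchy`), so the polynomial
relations carry over. The determinant is a divided-difference computation (`eval_mul_cauchy_sub`).

Finally C_n is diagonal with logarithmic derivative ±ℓ, the same for all branches, so the four
relations assemble into z(1-z)Z_n' = A Z_n, and det Z_n = 1 allows division by Z_n (`smul_M`). The
second form of A is the first rewritten by the coefficient identities. -/

noncomputable section

namespace JacobiOPUC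

open Complex Polynomial ComplexConjugate

/-! ### The weight on the circle and its integrability -/

/-- The positive density `e^{η(π-θ)} (2 sin(θ/2))^{2λ}` of the weight on the circle. -/
def density (b : ℂ) (θ : ℝ) : ℝ :=
  Real.exp (b.im * (Real.pi - θ)) * (2 * Real.sin (θ / 2)) ^ (2 * b.re)

theorem two_mul_sin_half_pos {θ : ℝ} (hθ : θ ∈ Set.Ioo 0 (2 * Real.pi)) :
    0 < 2 * Real.sin (θ / 2) :=
  mul_pos two_pos (Real.sin_pos_of_pos_of_lt_pi (by linarith [hθ.1]) (by linarith [hθ.2]))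

theorem density_pos (b : ℂ) {θ : ℝ} (hθ : θ ∈ Set.Ioo 0 (2 * Real.pi)) : 0 < density b θ :=
  mul_pos (Real.exp_pos _) (Real.rpow_pos_of_pos (two_mul_sin_half_pos hθ) _)

theorem neg_circleMap (θ : ℝ) : -circleMap 0 1 θ = exp ((θ - Real.pi : ℝ) * I) := by
  rw [circleMap_zero]
  push_cast
  rw [one_mul, sub_mul, exp_sub, exp_pi_mul_I, div_neg, div_one]

theorem one_sub_circleMap (θ : ℝ) :
    1 - circleMap 0 1 θ = (2 * Real.sin (θ / 2) : ℝ) * exp (((θ - Real.pi) / 2 : ℝ) * I) := by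
  have h1 : exp (((θ - Real.pi) / 2 : ℝ) * I) = exp ((θ / 2) * I) * (-I) := by
    rw [show (((θ - Real.pi) / 2 : ℝ) : ℂ) * I = (θ / 2) * I - Real.pi / 2 * I by push_cast; ring,
      exp_sub, exp_pi_div_two_mul_I]
    rw [div_eq_mul_inv, inv_I]
  have h2 : circleMap 0 1 θ = exp ((θ / 2) * I) * exp ((θ / 2) * I) := by
    rw [← exp_add, circleMap_zero, ofReal_one, one_mul]
    congr 1
    ring
  have h3 : exp ((θ / 2) * I) * exp (-(θ / 2) * I) = 1 := by
    rw [← exp_add]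
    simp
  rw [h1, h2]
  push_cast
  rw [Complex.sin]
  linear_combination (-1 : ℂ) * h3 + (exp ((θ / 2) * I) * exp (-(θ / 2) * I) -
    exp ((θ / 2) * I) * exp ((θ / 2) * I)) * I_sq

theorem circleMap_ne_one {θ : ℝ} (hθ : θ ∈ Set.Ioo 0 (2 * Real.pi)) : circleMap 0 1 θ ≠ 1 := by
  intro h
  have := one_sub_circleMap θ
  rw [h, sub_self] at this
  rcases mul_eq_zero.mp this.symm with h | h
  · exact (two_mul_sin_half_pos hθ).ne' (ofReal_eq_zero.mp h)
  · exact exp_ne_zero _ h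

theorem nu_circleMap (b : ℂ) {θ : ℝ} (hθ : θ ∈ Set.Ioo 0 (2 * Real.pi)) :
    nu b (circleMap 0 1 θ) = (density b θ : ℂ) := by
  have hs := two_mul_sin_half_pos hθ
  have l1 : log (-circleMap 0 1 θ) = ((θ - Real.pi : ℝ) : ℂ) * I := by
    rw [neg_circleMap, log_exp] <;> simp <;> linarith [hθ.1, hθ.2]
  have l2 : log (1 - circleMap 0 1 θ) =
      (Real.log (2 * Real.sin (θ / 2)) : ℂ) + (((θ - Real.pi) / 2 : ℝ) : ℂ) * I := by
    rw [one_sub_circleMap, log_ofReal_mul hs (exp_ne_zero _), log_exp] <;> simp <;>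
      linarith [hθ.1, hθ.2, Real.pi_pos]
  have n1 : -circleMap 0 1 θ ≠ 0 := by rw [neg_circleMap]; exact exp_ne_zero _
  have n2 : 1 - circleMap 0 1 θ ≠ 0 := sub_ne_zero.mpr (circleMap_ne_one hθ).symm
  rw [nu, cpow_def_of_ne_zero n1, cpow_def_of_ne_zero n2, l1, l2, ← exp_add, density,
    Real.rpow_def_of_pos hs, ← Real.exp_add, ofReal_exp]
  congr 1
  apply Complex.ext
  · simp
    ring
  · simp
    ring

theorem continuous_exp_mul (b : ℂ) : Continuous fun θ : ℝ => Real.exp (b.im * (Real.pi - θ)) := by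
  fun_prop

/-- Since 2 sin(θ/2) = θ sinc(θ/2) and sinc has no zero on [0, π/2], the integrand is θ^s times a
continuous function. -/
theorem intervalIntegrable_sin_rpow_left {s : ℝ} (hs : -1 < s) :
    IntervalIntegrable (fun θ : ℝ => (2 * Real.sin (θ / 2)) ^ s) MeasureTheory.volume 0 Real.pi := by
  have h0 : ContinuousOn (fun θ : ℝ => Real.sinc (θ / 2) ^ s) (Set.uIcc 0 Real.pi) := by
    apply ContinuousOn.rpow_const
    · exact (Real.continuous_sinc.comp (continuous_id.div_const 2)).continuousOn
    · intro θ hθ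
      rw [Set.uIcc_of_le Real.pi_pos.le] at hθ
      left
      rcases hθ.1.eq_or_lt with h | h
      · simp [← h]
      · rw [Real.sinc_of_ne_zero (by linarith)]
        exact (div_pos (Real.sin_pos_of_pos_of_lt_pi (by linarith)
          (by linarith [hθ.2, Real.pi_pos])) (by linarith)).ne'
  refine ((intervalIntegral.intervalIntegrable_rpow' hs (a := 0) (b := Real.pi)).mul_continuousOn
    h0).congr ?_
  intro θ hθ
  rw [Set.uIoc_of_le Real.pi_pos.le] at hθ
  have hθ0 : θ / 2 ≠ 0 := by linarith [hθ.1]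
  have : 0 < Real.sin (θ / 2) := Real.sin_pos_of_pos_of_lt_pi (by linarith [hθ.1])
          (by linarith [hθ.2, Real.pi_pos])
  have hh : 0 ≤ Real.sinc (θ / 2) := by
    rw [Real.sinc_of_ne_zero hθ0]
    exact (div_pos this (by linarith [hθ.1])).le
  show θ ^ s * Real.sinc (θ / 2) ^ s = (2 * Real.sin (θ / 2)) ^ s
  rw [← Real.mul_rpow hθ.1.le hh, Real.sinc_of_ne_zero hθ0]
  congr 1
  field_simp [hθ.1.ne']

theorem intervalIntegrable_density {b : ℂ} (hb : -1 / 2 < b.re) :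
    IntervalIntegrable (density b) MeasureTheory.volume 0 (2 * Real.pi) := by
  have hs : -1 < 2 * b.re := by linarith
  have h1 := intervalIntegrable_sin_rpow_left hs
  have h2 := h1.comp_sub_left (2 * Real.pi)
  -- The singularity at 2π is that at 0 reflected by θ ↦ 2π - θ.
  have h3 : IntervalIntegrable (fun θ : ℝ => (2 * Real.sin (θ / 2)) ^ (2 * b.re))
      MeasureTheory.volume Real.pi (2 * Real.pi) := by
    have e1 : 2 * Real.pi - Real.pi = Real.pi := by ring
    rw [sub_zero, e1] at h2
    refine h2.symm.congr ?_
    intro θ _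
    show (2 * Real.sin ((2 * Real.pi - θ) / 2)) ^ (2 * b.re) = _
    rw [show (2 * Real.pi - θ) / 2 = Real.pi - θ / 2 by ring, Real.sin_pi_sub]
  exact (h1.trans h3).continuousOn_mul (continuous_exp_mul b).continuousOn

theorem ae_mem_Ioo :
    ∀ᵐ θ ∂MeasureTheory.volume, θ ∈ Set.uIoc 0 (2 * Real.pi) → θ ∈ Set.Ioo 0 (2 * Real.pi) := by
  have : ({2 * Real.pi} : Set ℝ)ᶜ ∈ MeasureTheory.ae MeasureTheory.volume :=
    MeasureTheory.compl_mem_ae_iff.mpr Real.volume_singleton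
  filter_upwards [this] with θ h1 h2
  rw [Set.uIoc_of_le Real.two_pi_pos.le] at h2
  exact ⟨h2.1, lt_of_le_of_ne h2.2 h1⟩

/-! ### The circle functional and integration by parts -/

/-- Integration of a function on the unit circle against `dμ`. -/
def circleFunctional (b : ℂ) (f : ℂ → ℂ) : ℂ :=
  ∫ θ in 0..2 * Real.pi, f (circleMap 0 1 θ) * density b θ

theorem circleIntegral_nu (b : ℂ) (f : ℂ → ℂ) :
    (∮ z in C(0, 1), f z * nu b z) = I * circleFunctional b (fun z => z * f z) := by
  rw [circleIntegral, circleFunctional, ← intervalIntegral.integral_const_mul]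
  apply intervalIntegral.integral_congr_ae
  filter_upwards [ae_mem_Ioo] with θ h1 h2
  rw [nu_circleMap b (h1 h2), deriv_circleMap, smul_eq_mul]
  ring

theorem circleMap_mem_sphere_zero_one (θ : ℝ) : circleMap 0 1 θ ∈ Metric.sphere (0 : ℂ) 1 :=
  circleMap_mem_sphere 0 zero_le_one θ

theorem circleFunctional_congr {b : ℂ} {f g : ℂ → ℂ}
    (h : ∀ z ∈ Metric.sphere (0 : ℂ) 1, f z = g z) :
    circleFunctional b f = circleFunctional b g := by
  simp only [circleFunctional, h _ (circleMap_mem_sphere_zero_one _)]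

theorem intervalIntegrable_mul_density {b : ℂ} (hb : -1 / 2 < b.re) {f : ℂ → ℂ}
    (hf : ContinuousOn f (Metric.sphere 0 1)) :
    IntervalIntegrable (fun θ : ℝ => f (circleMap 0 1 θ) * density b θ) MeasureTheory.volume
      0 (2 * Real.pi) :=
  IntervalIntegrable.continuousOn_mul ⟨(intervalIntegrable_density hb).1.ofReal,
    (intervalIntegrable_density hb).2.ofReal⟩ (hf.comp (continuous_circleMap 0 1).continuousOn
      fun θ _ => circleMap_mem_sphere_zero_one θ)

theorem circleFunctional_add {b : ℂ} (hb : -1 / 2 < b.re) {f g : ℂ → ℂ}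
    (hf : ContinuousOn f (Metric.sphere 0 1)) (hg : ContinuousOn g (Metric.sphere 0 1)) :
    circleFunctional b (fun z => f z + g z) = circleFunctional b f + circleFunctional b g := by
  simp only [circleFunctional, add_mul]
  exact intervalIntegral.integral_add (intervalIntegrable_mul_density hb hf)
    (intervalIntegrable_mul_density hb hg)

theorem circleFunctional_const_mul (b c : ℂ) (f : ℂ → ℂ) :
    circleFunctional b (fun z => c * f z) = c * circleFunctional b f := by
  simp only [circleFunctional, mul_assoc]
  exact intervalIntegral.integral_const_mul _ _

theorem circleFunctional_conj (b : ℂ) (f : ℂ → ℂ) :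
    circleFunctional b (fun z => conj (f z)) = conj (circleFunctional b f) := by
  simp only [circleFunctional, intervalIntegral.integral_of_le Real.two_pi_pos.le]
  rw [← integral_conj]
  simp

/-- Away from 1 on the circle, -z and 1 - z both avoid the branch cut. Multiplying the logarithmic
derivative by z(1-z) gives -(b̄ + bz), the Pearson equation. -/
theorem hasDerivAt_nu (b : ℂ) {z : ℂ} (hz : z ∈ Metric.sphere (0 : ℂ) 1) (h1 : z ≠ 1) :
    HasDerivAt (nu b) (nu b z * (-conj b / z - (b + conj b) / (1 - z))) z := by
  have hz1 : ‖z‖ = 1 := by simpa using hz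
  have hre : z.re < 1 := by
    refine lt_of_le_of_ne (hz1 ▸ re_le_norm z) fun h => h1 ?_
    have h2 : z.re ^ 2 + z.im ^ 2 = 1 := by
      have := Complex.sq_norm z
      rw [hz1, normSq_apply] at this
      linarith
    have h3 : z.im = 0 := by
      have : z.im ^ 2 = 0 := by rw [h] at h2; linarith
      exact pow_eq_zero_iff two_ne_zero |>.mp this
    exact Complex.ext h h3
  have m2 : 1 - z ∈ slitPlane := Or.inl (by simpa using hre)
  have m1 : -z ∈ slitPlane := by
    rw [mem_slitPlane_iff_not_le_zero]
    intro hle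
    rw [Complex.le_def] at hle
    have him : z.im = 0 := by simpa using hle.2
    have hre0 : 0 ≤ z.re := by simpa using hle.1
    have h2 := Complex.sq_norm z
    rw [hz1, normSq_apply, him] at h2
    nlinarith
  have z0 : z ≠ 0 := by rintro rfl; simp at hz1
  have z1 : 1 - z ≠ 0 := slitPlane_ne_zero m2
  have d1 := (hasDerivAt_neg z).cpow_const (c := -conj b) m1
  have d2 := ((hasDerivAt_id z).const_sub 1).cpow_const (c := b + conj b) m2
  refine (d1.mul d2).congr_deriv ?_
  simp only [nu, id]
  rw [cpow_sub _ _ (neg_ne_zero.mpr z0), cpow_sub _ _ z1, cpow_one, cpow_one]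
  field_simp
  ring

/-- The factor 1 - t raises the exponent to 2 Re b + 1 > 0, so the boundary terms vanish even when ν
itself blows up at 1. -/
theorem norm_one_sub_mul_nu (b : ℂ) {θ : ℝ} (hθ : θ ∈ Set.Ioo 0 (2 * Real.pi)) :
    ‖(1 - circleMap 0 1 θ) * nu b (circleMap 0 1 θ)‖ =
      Real.exp (b.im * (Real.pi - θ)) * (2 * Real.sin (θ / 2)) ^ (2 * b.re + 1) := by
  have hs := two_mul_sin_half_pos hθ
  rw [nu_circleMap b hθ, norm_mul, one_sub_circleMap, norm_mul, norm_exp_ofReal_mul_I, norm_real,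
    norm_real, Real.norm_of_nonneg hs.le, Real.norm_of_nonneg (density_pos b hθ).le, density,
    Real.rpow_add hs, Real.rpow_one]
  ring

theorem continuous_boundary_factor {b : ℂ} (hb : -1 / 2 < b.re) :
    Continuous fun θ : ℝ =>
      Real.exp (b.im * (Real.pi - θ)) * (2 * Real.sin (θ / 2)) ^ (2 * b.re + 1) := by
  refine (by fun_prop : Continuous fun θ : ℝ => Real.exp (b.im * (Real.pi - θ))).mul ?_
  exact (by fun_prop : Continuous fun θ : ℝ => 2 * Real.sin (θ / 2)).rpow_const
    fun θ => Or.inr (by linarith)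

/-- Integration by parts: the total derivative of `(1 - t) g(t) ν(t)` has mean zero. -/
theorem circleFunctional_deriv_eq_zero {b : ℂ} (hb : -1 / 2 < b.re) {g g' : ℂ → ℂ}
    (hg : ∀ z ∈ Metric.sphere (0 : ℂ) 1, HasDerivAt g (g' z) z)
    (hg' : ContinuousOn g' (Metric.sphere 0 1)) :
    circleFunctional b
      (fun t => (1 - t) * t * g' t - t * g t - (conj b + b * t) * g t) = 0 := by
  have hgc : ContinuousOn g (Metric.sphere 0 1) := fun z hz =>
    (hg z hz).continuousAt.continuousWithinAt
  have hcont : ContinuousOn (fun t => (1 - t) * t * g' t - t * g t - (conj b + b * t) * g t)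
      (Metric.sphere 0 1) := by fun_prop
  have hint := (intervalIntegrable_mul_density hb hcont).const_mul I
  have key : ∀ θ ∈ Set.Ioo 0 (2 * Real.pi),
      HasDerivAt (fun θ : ℝ => g (circleMap 0 1 θ) *
        ((1 - circleMap 0 1 θ) * nu b (circleMap 0 1 θ)))
        (I * (((1 - circleMap 0 1 θ) * circleMap 0 1 θ * g' (circleMap 0 1 θ) -
          circleMap 0 1 θ * g (circleMap 0 1 θ) -
          (conj b + b * circleMap 0 1 θ) * g (circleMap 0 1 θ)) * density b θ)) θ := by
    intro θ hθ
    have hm := circleMap_mem_sphere_zero_one θ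
    have hne := circleMap_ne_one hθ
    have z0 : circleMap 0 1 θ ≠ 0 := circleMap_ne_center one_ne_zero
    have z1 : 1 - circleMap 0 1 θ ≠ 0 := sub_ne_zero.mpr hne.symm
    have hd := ((hg _ hm).mul (((hasDerivAt_id _).const_sub 1).mul (hasDerivAt_nu b hm hne))).comp
      θ (hasDerivAt_circleMap 0 1 θ)
    refine hd.congr_deriv ?_
    rw [← nu_circleMap b hθ]
    simp only [id, Pi.mul_apply]
    field_simp
    ring
  have lim : ∀ (l : Filter ℝ) (θ₀ : ℝ), l ≤ nhds θ₀ → (∀ᶠ θ in l, θ ∈ Set.Ioo 0 (2 * Real.pi)) →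
      Real.sin (θ₀ / 2) = 0 →
      Filter.Tendsto (fun θ : ℝ => g (circleMap 0 1 θ) *
        ((1 - circleMap 0 1 θ) * nu b (circleMap 0 1 θ))) l (nhds 0) := by
    intro l θ₀ hl he hs
    have t1 : Filter.Tendsto (fun θ : ℝ => g (circleMap 0 1 θ)) l (nhds (g (circleMap 0 1 θ₀))) :=
      ((hg _ (circleMap_mem_sphere_zero_one θ₀)).continuousAt.comp
        (continuous_circleMap 0 1).continuousAt).tendsto.mono_left hl
    have t2 : Filter.Tendsto (fun θ : ℝ => (1 - circleMap 0 1 θ) * nu b (circleMap 0 1 θ)) l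
        (nhds 0) := by
      rw [tendsto_zero_iff_norm_tendsto_zero]
      have := ((continuous_boundary_factor hb).tendsto θ₀).mono_left hl
      rw [hs, mul_zero, Real.zero_rpow (by linarith), mul_zero] at this
      refine this.congr' ?_
      filter_upwards [he] with θ hθ
      rw [norm_one_sub_mul_nu b hθ]
    simpa using t1.mul t2
  -- The weight may be singular at t = 1, so the fundamental theorem is used on the open interval,
  -- with limits at its ends.
  have := intervalIntegral.integral_eq_sub_of_hasDerivAt_of_tendsto Real.two_pi_pos key hint
    (lim _ 0 nhdsWithin_le_nhds (Ioo_mem_nhdsGT Real.two_pi_pos) (by simp))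
    (lim _ (2 * Real.pi) nhdsWithin_le_nhds (Ioo_mem_nhdsLT Real.two_pi_pos) (by simp))
  rw [intervalIntegral.integral_const_mul, sub_zero] at this
  exact (mul_eq_zero.mp this).resolve_left I_ne_zero

/-! ### The sesquilinear pairing on polynomials -/

theorem pairing_eq_circleFunctional (b : ℂ) (p q : ℂ[X]) :
    pairing b p q = circleFunctional b (fun z => p.eval z * conj (q.eval z)) := by
  have h : ∀ z : ℂ, p.eval z * conj (q.eval z) * (nu b z / (I * z)) =
      p.eval z * conj (q.eval z) / (I * z) * nu b z := fun z => by ring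
  simp only [pairing, h]
  rw [circleIntegral_nu b (fun z => p.eval z * conj (q.eval z) / (I * z)),
    ← circleFunctional_const_mul]
  apply circleFunctional_congr
  intro z hz
  have z0 : z ≠ 0 := ne_zero_of_mem_unit_sphere ⟨z, hz⟩
  field_simp

theorem conj_eq_inv_of_mem_sphere {z : ℂ} (hz : z ∈ Metric.sphere (0 : ℂ) 1) : conj z = z⁻¹ :=
  (inv_eq_conj (by simpa using hz)).symm

theorem continuousOn_eval_mul_conj (p q : ℂ[X]) (s : Set ℂ) :
    ContinuousOn (fun z => p.eval z * conj (q.eval z)) s :=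
  (p.continuous.mul (continuous_conj.comp q.continuous)).continuousOn

section Sesquilinear

variable {b : ℂ}

theorem pairing_add_left (hb : -1 / 2 < b.re) (p₁ p₂ q : ℂ[X]) :
    pairing b (p₁ + p₂) q = pairing b p₁ q + pairing b p₂ q := by
  simp only [pairing_eq_circleFunctional, eval_add, add_mul]
  exact circleFunctional_add hb (continuousOn_eval_mul_conj _ _ _)
    (continuousOn_eval_mul_conj _ _ _)

theorem pairing_C_mul_left (c : ℂ) (p q : ℂ[X]) :
    pairing b (C c * p) q = c * pairing b p q := by
  simp only [pairing_eq_circleFunctional, eval_mul, eval_C, mul_assoc]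
  exact circleFunctional_const_mul b c _

theorem conj_pairing (p q : ℂ[X]) : conj (pairing b p q) = pairing b q p := by
  simp only [pairing_eq_circleFunctional, ← circleFunctional_conj, map_mul, conj_conj, mul_comm]

theorem pairing_sub_left (hb : -1 / 2 < b.re) (p₁ p₂ q : ℂ[X]) :
    pairing b (p₁ - p₂) q = pairing b p₁ q - pairing b p₂ q := by
  have := pairing_add_left hb p₁ (C (-1) * p₂) q
  rw [pairing_C_mul_left] at this
  simpa [sub_eq_add_neg] using this

theorem pairing_add_right (hb : -1 / 2 < b.re) (p q₁ q₂ : ℂ[X]) :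
    pairing b p (q₁ + q₂) = pairing b p q₁ + pairing b p q₂ := by
  simp only [← conj_pairing (b := b) _ p, pairing_add_left hb, map_add]

theorem pairing_C_mul_right (c : ℂ) (p q : ℂ[X]) :
    pairing b p (C c * q) = conj c * pairing b p q := by
  simp only [← conj_pairing (b := b) _ p, pairing_C_mul_left, map_mul]

theorem pairing_sub_right (hb : -1 / 2 < b.re) (p q₁ q₂ : ℂ[X]) :
    pairing b p (q₁ - q₂) = pairing b p q₁ - pairing b p q₂ := by
  simp only [← conj_pairing (b := b) _ p, pairing_sub_left hb, map_sub]

theorem pairing_zero_right (p : ℂ[X]) : pairing b p 0 = 0 := by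
  simpa using pairing_C_mul_right (b := b) 0 p 0

/-- Restricting the hypothesis to the monomials occurring in `q` lets coefficient cancellations and
orthogonality share the work. -/
theorem pairing_eq_zero_of_coeff (hb : -1 / 2 < b.re) {p q : ℂ[X]}
    (h : ∀ j, q.coeff j ≠ 0 → pairing b p (X ^ j) = 0) : pairing b p q = 0 := by
  let f : ℂ[X] →+ ℂ := ⟨⟨pairing b p, pairing_zero_right p⟩, pairing_add_right hb p⟩
  show f q = 0
  rw [q.as_sum_support_C_mul_X_pow, map_sum]
  apply Finset.sum_eq_zero
  intro j hj
  show pairing b p (C (q.coeff j) * X ^ j) = 0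
  rw [pairing_C_mul_right, h j (mem_support_iff.mp hj), mul_zero]

theorem pairing_X_mul_X_mul (p q : ℂ[X]) : pairing b (X * p) (X * q) = pairing b p q := by
  simp only [pairing_eq_circleFunctional]
  apply circleFunctional_congr
  intro z hz
  have z0 : z ≠ 0 := ne_zero_of_mem_unit_sphere ⟨z, hz⟩
  simp only [eval_mul, eval_X, map_mul, conj_eq_inv_of_mem_sphere hz]
  field_simp

theorem pairing_X_mul_X_pow_succ (p : ℂ[X]) (j : ℕ) :
    pairing b (X * p) (X ^ (j + 1)) = pairing b p (X ^ j) := by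
  rw [pow_succ', pairing_X_mul_X_mul]

end Sesquilinear

/-- The pairing is positive definite on polynomials. -/
theorem exists_pairing_self {b : ℂ} (hb : -1 / 2 < b.re) {p : ℂ[X]} (hp : p ≠ 0) :
    ∃ r : ℝ, 0 < r ∧ pairing b p p = (r : ℂ) := by
  let f : ℝ → ℝ := fun θ => ‖p.eval (circleMap 0 1 θ)‖ ^ 2 * density b θ
  refine ⟨∫ θ in 0..2 * Real.pi, f θ, ?_, ?_⟩
  · have hcont : Continuous fun θ : ℝ => ‖p.eval (circleMap 0 1 θ)‖ ^ 2 :=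
      ((p.continuous.comp (continuous_circleMap 0 1)).norm).pow 2
    have hint : IntervalIntegrable f MeasureTheory.volume 0 (2 * Real.pi) :=
      (intervalIntegrable_density hb).continuousOn_mul hcont.continuousOn
    have hae := ae_mem_Ioo
    rw [Set.uIoc_of_le Real.two_pi_pos.le] at hae
    have hnonneg : 0 ≤ᵐ[MeasureTheory.volume.restrict (Set.Ioc 0 (2 * Real.pi))] f := by
      rw [Filter.EventuallyLE, MeasureTheory.ae_restrict_iff' measurableSet_Ioc]
      filter_upwards [hae] with θ h1 h2
      exact mul_nonneg (sq_nonneg _) (density_pos b (h1 h2)).le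
    rw [intervalIntegral.integral_of_le Real.two_pi_pos.le,
      MeasureTheory.setIntegral_pos_iff_support_of_nonneg_ae hnonneg hint.1]
    -- Strict positivity: finitely many roots have a countable, hence null, preimage in θ, and off
    -- it the integrand is positive.
    have hcount : (circleMap 0 1 ⁻¹' (p.roots.toFinset : Set ℂ)).Countable :=
      p.roots.toFinset.countable_toSet.preimage_circleMap 0 one_ne_zero
    have hsub : Set.Ioo 0 (2 * Real.pi) \ circleMap 0 1 ⁻¹' (p.roots.toFinset : Set ℂ) ⊆
        Function.support f ∩ Set.Ioc 0 (2 * Real.pi) := by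
      rintro θ ⟨hθ, hr⟩
      refine ⟨?_, hθ.1, hθ.2.le⟩
      have : p.eval (circleMap 0 1 θ) ≠ 0 := fun h => hr (by simp [hp, h])
      exact (mul_pos (pow_pos (norm_pos_iff.mpr this) 2) (density_pos b hθ)).ne'
    refine lt_of_lt_of_le ?_ (MeasureTheory.measure_mono hsub)
    rw [MeasureTheory.measure_sdiff_null (hcount.measure_zero _), Real.volume_Ioo]
    simpa using Real.two_pi_pos
  · rw [pairing_eq_circleFunctional, circleFunctional, ← intervalIntegral.integral_ofReal]
    congr 1
    ext θ
    rw [mul_conj, normSq_eq_norm_sq, ← ofReal_mul]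

theorem pairing_self_ne_zero {b : ℂ} (hb : -1 / 2 < b.re) {p : ℂ[X]} (hp : p ≠ 0) :
    pairing b p p ≠ 0 := by
  obtain ⟨r, hr, h⟩ := exists_pairing_self hb hp
  rw [h]
  exact_mod_cast hr.ne'

/-- A polynomial orthogonal to all monomials that occur in it is zero. -/
theorem eq_zero_of_pairing_X_pow {b : ℂ} (hb : -1 / 2 < b.re) {p : ℂ[X]}
    (h : ∀ j, p.coeff j ≠ 0 → pairing b p (X ^ j) = 0) : p = 0 := by
  by_contra hp
  exact pairing_self_ne_zero hb hp (pairing_eq_zero_of_coeff hb h)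

/-! ### Reversed polynomials and the Pearson relation -/

/-- The reversed polynomial `z^n conj(p(1 / conj z))`. -/
def conjReflect (n : ℕ) (p : ℂ[X]) : ℂ[X] := (p.map (starRingEnd ℂ)).reflect n

theorem coeff_conjReflect {n j : ℕ} (p : ℂ[X]) (hj : j ≤ n) :
    (conjReflect n p).coeff j = conj (p.coeff (n - j)) := by
  rw [conjReflect, coeff_reflect, revAt_le hj, coeff_map]

theorem coeff_conjReflect_of_lt {n j : ℕ} {p : ℂ[X]} (hp : p.natDegree ≤ n) (hj : n < j) :
    (conjReflect n p).coeff j = 0 := by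
  rw [conjReflect, coeff_reflect, revAt_eq_self_of_lt hj, coeff_map,
    coeff_eq_zero_of_natDegree_lt (hp.trans_lt hj), map_zero]

theorem eval_conjReflect {n : ℕ} {p : ℂ[X]} (hp : p.natDegree ≤ n) {z : ℂ}
    (hz : z ∈ Metric.sphere (0 : ℂ) 1) :
    (conjReflect n p).eval z = z ^ n * conj (p.eval z) := by
  have z0 : z ≠ 0 := ne_zero_of_mem_unit_sphere ⟨z, hz⟩
  let : Invertible z⁻¹ := invertibleOfNonzero (inv_ne_zero z0)
  have h := eval₂_reflect_mul_pow (RingHom.id ℂ) z⁻¹ n (p.map (starRingEnd ℂ))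
    ((natDegree_map_le).trans hp)
  rw [invOf_eq_inv, inv_inv, ← conj_eq_inv_of_mem_sphere hz] at h
  have h2 : eval₂ (RingHom.id ℂ) (conj z) (p.map (starRingEnd ℂ)) = conj (p.eval z) := by
    rw [eval₂_id, eval_map, eval₂_hom]
  rw [h2, eval₂_id, conj_eq_inv_of_mem_sphere hz] at h
  rw [← h, conjReflect, inv_pow]
  field_simp

section Reflect

variable {b : ℂ} {n : ℕ} {p q : ℂ[X]}

theorem pairing_conjReflect_X_pow (hp : p.natDegree ≤ n) {j : ℕ} (hj : j ≤ n) :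
    pairing b (conjReflect n p) (X ^ j) = conj (pairing b p (X ^ (n - j))) := by
  rw [conj_pairing]
  simp only [pairing_eq_circleFunctional]
  apply circleFunctional_congr
  intro z hz
  have z0 : z ≠ 0 := ne_zero_of_mem_unit_sphere ⟨z, hz⟩
  simp only [eval_conjReflect hp hz, eval_pow, eval_X, map_pow, conj_eq_inv_of_mem_sphere hz]
  rw [pow_sub₀ z z0 hj, inv_pow]
  ring

theorem pairing_conjReflect_conjReflect (hp : p.natDegree ≤ n) (hq : q.natDegree ≤ n) :
    pairing b (conjReflect n p) (conjReflect n q) = pairing b q p := by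
  simp only [pairing_eq_circleFunctional]
  apply circleFunctional_congr
  intro z hz
  have z0 : z ≠ 0 := ne_zero_of_mem_unit_sphere ⟨z, hz⟩
  simp only [eval_conjReflect hp hz, eval_conjReflect hq hz, map_mul, map_pow, conj_conj,
    conj_eq_inv_of_mem_sphere hz, inv_pow]
  field_simp

end Reflect

/-- The Pearson-type relation for the weight, in terms of the pairing. -/
theorem pairing_derivative {b : ℂ} (hb : -1 / 2 < b.re) (p : ℂ[X]) (j : ℕ) :
    pairing b ((1 - X) * X * derivative p -
      (C (b + 1 - j) * (X * p) + C (j + conj b) * p)) (X ^ j) = 0 := by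
  -- On the circle the conjugate of t^j is t^{-j}, so the pairing with X^j becomes a holomorphic
  -- integrand that can be integrated by parts.
  have h := circleFunctional_deriv_eq_zero hb (g := fun t => p.eval t * (t ^ j)⁻¹)
    (g' := fun t => (derivative p).eval t * (t ^ j)⁻¹ +
      p.eval t * (-(j * t ^ (j - 1)) / (t ^ j) ^ 2)) ?_ ?_
  · rw [pairing_eq_circleFunctional, ← h]
    apply circleFunctional_congr
    intro z hz
    have z0 : z ≠ 0 := ne_zero_of_mem_unit_sphere ⟨z, hz⟩
    simp only [eval_sub, eval_add, eval_mul, eval_one, eval_C, eval_X, eval_pow, map_pow,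
      conj_eq_inv_of_mem_sphere hz, inv_pow]
    rcases j with _ | j
    · simp
      ring
    · simp only [add_tsub_cancel_right]
      push_cast
      field_simp
      ring
  · intro z hz
    have z0 : z ≠ 0 := ne_zero_of_mem_unit_sphere ⟨z, hz⟩
    exact (p.hasDerivAt z).mul ((hasDerivAt_pow j z).inv (pow_ne_zero j z0))
  · intro z hz
    have z0 : z ≠ 0 := ne_zero_of_mem_unit_sphere ⟨z, hz⟩
    have z1 : z ^ j ≠ 0 := pow_ne_zero j z0
    have z2 : (z ^ j) ^ 2 ≠ 0 := pow_ne_zero 2 z1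
    have c1 := p.continuous.continuousAt (x := z)
    have c2 := (derivative p).continuous.continuousAt (x := z)
    apply ContinuousAt.continuousWithinAt
    fun_prop (disch := assumption)

/-! ### Existence and uniqueness of the orthogonal polynomials -/

/-- `p` is monic of degree `n` and orthogonal to all polynomials of lower degree. -/
structure IsOrthogonalMonic (b : ℂ) (n : ℕ) (p : ℂ[X]) : Prop where
  monic : p.Monic
  natDegree_eq : p.natDegree = n
  pairing_X_pow : ∀ j < n, pairing b p (X ^ j) = 0

namespace IsOrthogonalMonic

variable {b : ℂ} {n : ℕ} {p q : ℂ[X]}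

theorem coeff_self (hp : IsOrthogonalMonic b n p) : p.coeff n = 1 := by
  rw [← hp.natDegree_eq]
  exact hp.monic

theorem pairing_eq_zero (hb : -1 / 2 < b.re) (hp : IsOrthogonalMonic b n p)
    (hq : ∀ j, n ≤ j → q.coeff j = 0) : pairing b p q = 0 :=
  pairing_eq_zero_of_coeff hb fun j hj => hp.pairing_X_pow j (by
    by_contra h
    exact hj (hq j (not_lt.mp h)))

theorem pairing_X_pow_self (hb : -1 / 2 < b.re) (hp : IsOrthogonalMonic b n p) :
    pairing b p (X ^ n) = pairing b p p := by
  rw [eq_comm, ← sub_eq_zero, ← pairing_sub_right hb]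
  apply hp.pairing_eq_zero hb
  intro j hj
  rw [coeff_sub, coeff_X_pow]
  rcases hj.eq_or_lt with rfl | h
  · simp [hp.coeff_self]
  · rw [coeff_eq_zero_of_natDegree_lt (by rw [hp.natDegree_eq]; exact h), if_neg h.ne', sub_zero]

theorem unique (hb : -1 / 2 < b.re) (hp : IsOrthogonalMonic b n p)
    (hq : IsOrthogonalMonic b n q) : p = q := by
  rw [← sub_eq_zero]
  apply eq_zero_of_pairing_X_pow hb
  intro j hj
  rw [pairing_sub_left hb]
  rcases lt_trichotomy j n with h | rfl | h
  · rw [hp.pairing_X_pow j h, hq.pairing_X_pow j h, sub_zero]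
  · simp [hp.coeff_self, hq.coeff_self] at hj
  · rw [coeff_sub, coeff_eq_zero_of_natDegree_lt (by rw [hp.natDegree_eq]; exact h),
      coeff_eq_zero_of_natDegree_lt (by rw [hq.natDegree_eq]; exact h)] at hj
    simp at hj

/-- A Szegő step in place of Gram-Schmidt: both X p and the reversed polynomial are already
orthogonal to X, …, X^n, so one constant suffices to kill the pairing with 1. -/
theorem exists_succ (hb : -1 / 2 < b.re) (hp : IsOrthogonalMonic b n p) :
    ∃ q, IsOrthogonalMonic b (n + 1) q := by
  have hne : pairing b (conjReflect n p) (X ^ 0) ≠ 0 := by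
    rw [pairing_conjReflect_X_pow hp.natDegree_eq.le (Nat.zero_le n), Nat.sub_zero,
      hp.pairing_X_pow_self hb]
    exact (_root_.map_ne_zero _).mpr (pairing_self_ne_zero hb hp.monic.ne_zero)
  let c := pairing b (X * p) (X ^ 0) / pairing b (conjReflect n p) (X ^ 0)
  have hdeg : (X * p).natDegree = n + 1 := by
    rw [natDegree_X_mul hp.monic.ne_zero, hp.natDegree_eq]
  have hlt : (C c * conjReflect n p).degree < (X * p).degree := by
    rw [degree_eq_natDegree (monic_X.mul hp.monic).ne_zero, hdeg, degree_lt_iff_coeff_zero]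
    intro m hm
    rw [coeff_C_mul, coeff_conjReflect_of_lt hp.natDegree_eq.le (by omega), mul_zero]
  refine ⟨X * p - C c * conjReflect n p, (monic_X.mul hp.monic).sub_of_left hlt, ?_, ?_⟩
  · rw [natDegree_eq_of_degree_eq (degree_sub_eq_left_of_degree_lt hlt), hdeg]
  · intro j hj
    rw [pairing_sub_left hb, pairing_C_mul_left]
    rcases j with _ | j
    · rw [div_mul_cancel₀ _ hne, sub_self]
    · rw [pairing_X_mul_X_pow_succ, hp.pairing_X_pow j (by omega),
        pairing_conjReflect_X_pow hp.natDegree_eq.le (by omega),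
        hp.pairing_X_pow _ (by omega)]
      simp

end IsOrthogonalMonic

theorem exists_isOrthogonalMonic {b : ℂ} (hb : -1 / 2 < b.re) (n : ℕ) :
    ∃ p, IsOrthogonalMonic b n p := by
  induction n with
  | zero => exact ⟨1, monic_one, natDegree_one, fun j hj => absurd hj (Nat.not_lt_zero j)⟩
  | succ n ih =>
    obtain ⟨p, hp⟩ := ih
    exact hp.exists_succ hb

namespace IsMonicOrthogonal

variable {b : ℂ} {Φ : ℕ → ℂ[X]} {κ : ℕ → ℝ}

theorem coeff_eq_zero (h : IsMonicOrthogonal b Φ κ) {n j : ℕ} (hj : n < j) : (Φ n).coeff j = 0 :=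
  coeff_eq_zero_of_natDegree_lt (by rwa [h.natDegree_eq])

theorem coeff_self (h : IsMonicOrthogonal b Φ κ) (n : ℕ) : (Φ n).coeff n = 1 := by
  have := h.monic n
  rwa [Monic, leadingCoeff, h.natDegree_eq] at this

/-- Strong induction on j: Φ_j differs from X^j only by lower monomials, already known to pair to
zero with Φ_n. -/
theorem isOrthogonalMonic (hb : -1 / 2 < b.re) (h : IsMonicOrthogonal b Φ κ) (n : ℕ) :
    IsOrthogonalMonic b n (Φ n) := by
  refine ⟨h.monic n, h.natDegree_eq n, ?_⟩
  intro j
  induction j using Nat.strong_induction_on with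
  | _ j ih =>
    intro hj
    have h1 : pairing b (Φ n) (Φ j - X ^ j) = 0 := by
      apply pairing_eq_zero_of_coeff hb
      intro i hi
      rcases lt_trichotomy i j with hij | rfl | hij
      · exact ih i hij (hij.trans hj)
      · simp [h.coeff_self] at hi
      · simp [h.coeff_eq_zero hij, coeff_X_pow, hij.ne'] at hi
    rw [pairing_sub_right hb, h.orthogonal n j hj.ne', zero_sub, neg_eq_zero] at h1
    exact h1

end IsMonicOrthogonal

theorem existsUnique_isMonicOrthogonal {b : ℂ} (hb : -1 / 2 < b.re) :
    ∃! P : (ℕ → ℂ[X]) × (ℕ → ℝ), IsMonicOrthogonal b P.1 P.2 := by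
  choose Φ hΦ using exists_isOrthogonalMonic hb
  choose r hr0 hr using fun n => exists_pairing_self hb (hΦ n).monic.ne_zero
  have hlt : ∀ n m, m < n → pairing b (Φ n) (Φ m) = 0 := fun n m hmn =>
    (hΦ n).pairing_eq_zero hb fun j hj =>
      coeff_eq_zero_of_natDegree_lt (by rw [(hΦ m).natDegree_eq]; omega)
  have hmain : IsMonicOrthogonal b Φ (fun n => Real.sqrt (r n)⁻¹) := by
    refine ⟨fun n => (hΦ n).monic, fun n => (hΦ n).natDegree_eq,
      fun n => Real.sqrt_pos.mpr (inv_pos.mpr (hr0 n)), ?_, ?_⟩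
    · intro n m hnm
      rcases lt_or_gt_of_ne hnm with h | h
      · rw [← conj_pairing, hlt m n h, map_zero]
      · exact hlt n m h
    · intro n
      rw [hr, Real.sq_sqrt (inv_pos.mpr (hr0 n)).le, inv_inv]
  refine ⟨(Φ, _), hmain, ?_⟩
  rintro ⟨Ψ, κ⟩ h
  have hΨ : Ψ = Φ := funext fun n => (h.isOrthogonalMonic hb n).unique hb (hΦ n)
  subst hΨ
  refine Prod.ext rfl (funext fun n => ?_)
  have h1 := (h.norm_sq n).symm.trans (hmain.norm_sq n)
  have h2 := inv_injective (ofReal_injective h1)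
  exact (pow_left_inj₀ (h.kappa_pos n).le (hmain.kappa_pos n).le two_ne_zero).mp h2

/-! ### Szegő recursion, structure relations and Verblunsky coefficients -/

theorem alpha_natCast (Φ : ℕ → ℂ[X]) (m : ℕ) : alpha Φ m = -conj ((Φ (m + 1)).coeff 0) := by
  rw [alpha, coeff_zero_eq_eval_zero]
  norm_cast

theorem conj_alpha_natCast (Φ : ℕ → ℂ[X]) (m : ℕ) : conj (alpha Φ m) = -(Φ (m + 1)).coeff 0 := by
  rw [alpha_natCast, map_neg, conj_conj]

theorem norm_alpha_sq (Φ : ℕ → ℂ[X]) (m : ℕ) :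
    (‖alpha Φ m‖ : ℂ) ^ 2 = alpha Φ m * conj (alpha Φ m) := by
  rw [mul_conj, normSq_eq_norm_sq, ofReal_pow]

theorem coeff_X_mul_derivative (p : ℂ[X]) (j : ℕ) :
    (X * derivative p).coeff j = j * p.coeff j := by
  rcases j with _ | j
  · simp
  · rw [coeff_X_mul, coeff_derivative]
    push_cast
    ring

/-- This is Pearson tested against X^{j+1}; the factor X in (1-X)X p' cancels because multiplication
by X is an isometry. -/
theorem pairing_X_sub_one_mul_derivative {b : ℂ} (hb : -1 / 2 < b.re) (p : ℂ[X]) (j : ℕ) :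
    pairing b ((X - 1) * derivative p) (X ^ j) =
      -((b - j) * pairing b p (X ^ j) + (j + 1 + conj b) * pairing b p (X ^ (j + 1))) := by
  have h := pairing_derivative hb p (j + 1)
  have e : (1 - X) * X * derivative p = C (-1) * (X * ((X - 1) * derivative p)) := by
    rw [C_neg, C_1]
    ring
  rw [pairing_sub_left hb, pairing_add_left hb, e, pairing_C_mul_left, pairing_C_mul_left,
    pairing_C_mul_left, pairing_X_mul_X_pow_succ, pairing_X_mul_X_pow_succ] at h
  push_cast at h
  linear_combination -h

namespace IsMonicOrthogonal

variable {b : ℂ} {Φ : ℕ → ℂ[X]} {κ : ℕ → ℝ}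

theorem coeff_recip (Φ : ℕ → ℂ[X]) {m j : ℕ} (hj : j ≤ m) :
    (recip Φ m).coeff j = conj ((Φ m).coeff (m - j)) :=
  coeff_conjReflect _ hj

theorem coeff_recip_of_lt (h : IsMonicOrthogonal b Φ κ) {m j : ℕ} (hj : m < j) :
    (recip Φ m).coeff j = 0 :=
  coeff_conjReflect_of_lt (h.natDegree_eq m).le hj

theorem coeff_recip_zero (h : IsMonicOrthogonal b Φ κ) (m : ℕ) : (recip Φ m).coeff 0 = 1 := by
  rw [coeff_recip Φ (Nat.zero_le m), Nat.sub_zero, h.coeff_self, map_one]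

theorem coeff_recip_self (Φ : ℕ → ℂ[X]) (m : ℕ) :
    (recip Φ m).coeff m = conj ((Φ m).coeff 0) := by
  rw [coeff_recip Φ le_rfl, Nat.sub_self]

theorem pairing_X_pow (hb : -1 / 2 < b.re) (h : IsMonicOrthogonal b Φ κ) {n j : ℕ} (hj : j < n) :
    pairing b (Φ n) (X ^ j) = 0 :=
  (h.isOrthogonalMonic hb n).pairing_X_pow j hj

theorem pairing_X_pow_self (hb : -1 / 2 < b.re) (h : IsMonicOrthogonal b Φ κ) (n : ℕ) :
    pairing b (Φ n) (X ^ n) = pairing b (Φ n) (Φ n) :=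
  (h.isOrthogonalMonic hb n).pairing_X_pow_self hb

theorem pairing_recip_X_pow (hb : -1 / 2 < b.re) (h : IsMonicOrthogonal b Φ κ) {m j : ℕ}
    (h1 : 1 ≤ j) (hj : j ≤ m) : pairing b (recip Φ m) (X ^ j) = 0 := by
  rw [recip, ← conjReflect, pairing_conjReflect_X_pow (h.natDegree_eq m).le hj,
    h.pairing_X_pow hb (by omega), map_zero]

theorem pairing_recip_one (hb : -1 / 2 < b.re) (h : IsMonicOrthogonal b Φ κ) (m : ℕ) :
    pairing b (recip Φ m) (X ^ 0) = pairing b (Φ m) (Φ m) := by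
  rw [recip, ← conjReflect, pairing_conjReflect_X_pow (h.natDegree_eq m).le (Nat.zero_le m),
    Nat.sub_zero, h.pairing_X_pow_self hb, conj_pairing]

theorem pairing_self_ne_zero (hb : -1 / 2 < b.re) (h : IsMonicOrthogonal b Φ κ) (n : ℕ) :
    pairing b (Φ n) (Φ n) ≠ 0 :=
  JacobiOPUC.pairing_self_ne_zero hb (h.monic n).ne_zero

/-- The Szegő recursion. -/
theorem szego (hb : -1 / 2 < b.re) (h : IsMonicOrthogonal b Φ κ) (m : ℕ) :
    X * Φ m = Φ (m + 1) + C (conj (alpha Φ m)) * recip Φ m := by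
  rw [← sub_eq_zero]
  apply eq_zero_of_pairing_X_pow hb
  intro j hj
  -- The constant coefficient and those of index above m cancel; orthogonality handles the indices
  -- 1, …, m.
  rcases j with _ | j
  · refine absurd ?_ hj
    simp [h.coeff_recip_zero, conj_alpha_natCast]
  · have hjm : j < m := by
      by_contra hle
      refine hj ?_
      rw [coeff_sub, coeff_add, coeff_X_mul, coeff_C_mul, h.coeff_recip_of_lt (by omega)]
      rcases (not_lt.mp hle).eq_or_lt with rfl | hlt
      · simp [h.coeff_self]
      · simp [h.coeff_eq_zero hlt, h.coeff_eq_zero (Nat.succ_lt_succ hlt)]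
    rw [pairing_sub_left hb, pairing_add_left hb, pairing_C_mul_left, pairing_X_mul_X_pow_succ,
      h.pairing_X_pow hb hjm, h.pairing_X_pow hb (by omega),
      h.pairing_recip_X_pow hb (by omega) (by omega)]
    simp

/-- Pythagoras in the Szegő recursion: multiplication by X preserves norms, Φ_{m+1} is orthogonal to
Φ*_m, and Φ*_m has the norm of Φ_m. -/
theorem pairing_self_succ (hb : -1 / 2 < b.re) (h : IsMonicOrthogonal b Φ κ) (m : ℕ) :
    pairing b (Φ (m + 1)) (Φ (m + 1)) =
      (1 - alpha Φ m * conj (alpha Φ m)) * pairing b (Φ m) (Φ m) := by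
  have hs := h.szego hb m
  have h0 : pairing b (Φ (m + 1)) (recip Φ m) = 0 :=
    (h.isOrthogonalMonic hb (m + 1)).pairing_eq_zero hb fun j hj => h.coeff_recip_of_lt hj
  have h1 : pairing b (recip Φ m) (Φ (m + 1)) = 0 := by rw [← conj_pairing, h0, map_zero]
  have h2 : pairing b (recip Φ m) (recip Φ m) = pairing b (Φ m) (Φ m) :=
    pairing_conjReflect_conjReflect (h.natDegree_eq m).le (h.natDegree_eq m).le
  have h3 := pairing_X_mul_X_mul (b := b) (Φ m) (Φ m)
  rw [hs, pairing_add_left hb, pairing_add_right hb, pairing_add_right hb, pairing_C_mul_right,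
    pairing_C_mul_left, pairing_C_mul_left, pairing_C_mul_right, h0, h1, h2, conj_conj] at h3
  linear_combination h3

theorem one_sub_norm_alpha_sq_ne_zero (hb : -1 / 2 < b.re) (h : IsMonicOrthogonal b Φ κ)
    (m : ℕ) : 1 - alpha Φ m * conj (alpha Φ m) ≠ 0 :=
  left_ne_zero_of_mul (h.pairing_self_succ hb m ▸ h.pairing_self_ne_zero hb (m + 1))

/-- The lowering relation. -/
theorem X_sub_one_mul_derivative (hb : -1 / 2 < b.re) (h : IsMonicOrthogonal b Φ κ) (m : ℕ) :
    (X - 1) * derivative (Φ (m + 1)) =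
      C (-(conj b + (m + 1)) * (1 - alpha Φ m * conj (alpha Φ m))) * Φ m +
        C (m + 1 : ℂ) * Φ (m + 1) := by
  rw [← sub_eq_zero]
  apply eq_zero_of_pairing_X_pow hb
  intro j hj
  have hjm : j ≤ m := by
    by_contra hle
    refine hj ?_
    have hlt : m < j := not_le.mp hle
    rw [coeff_sub, coeff_add, coeff_C_mul, coeff_C_mul, sub_mul, coeff_sub, one_mul,
      coeff_X_mul_derivative, coeff_derivative, h.coeff_eq_zero hlt,
      h.coeff_eq_zero (Nat.succ_lt_succ hlt)]
    rcases (Nat.succ_le_of_lt hlt).eq_or_lt with rfl | h2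
    · push_cast
      ring
    · rw [h.coeff_eq_zero (by simpa using h2)]
      ring
  rw [pairing_sub_left hb, pairing_add_left hb, pairing_C_mul_left, pairing_C_mul_left,
    pairing_X_sub_one_mul_derivative hb, h.pairing_X_pow hb (Nat.lt_succ_of_le hjm)]
  -- Only j = m fixes a constant: Pearson leaves the squared norm of Φ_{m+1}, whose ratio to that of
  -- Φ_m is 1 - |α_m|².
  rcases hjm.eq_or_lt with rfl | hlt
  · rw [h.pairing_X_pow_self hb, h.pairing_X_pow_self hb, h.pairing_self_succ hb]
    ring
  · rw [h.pairing_X_pow hb (Nat.succ_lt_succ hlt), h.pairing_X_pow hb hlt]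
    ring

theorem coeff_subleading (hb : -1 / 2 < b.re) (h : IsMonicOrthogonal b Φ κ) (m : ℕ) :
    (Φ (m + 1)).coeff m = conj b - (conj b + (m + 1)) * (alpha Φ m * conj (alpha Φ m)) := by
  have h1 := congrArg (fun p => coeff p m) (h.X_sub_one_mul_derivative hb m)
  simp only [coeff_add, coeff_C_mul, sub_mul, coeff_sub, one_mul,
      coeff_X_mul_derivative, coeff_derivative, h.coeff_self] at h1
  linear_combination -h1

/-- This is the Verblunsky recursion in conjugate form. The lowering relation at X^0 and the Szegő
recursion at X^1 both contain the linear coefficient of Φ_{m+1}; eliminating it leaves the claim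
times 1 - |α_m|², which is nonzero. -/
theorem coeff_zero_succ (hb : -1 / 2 < b.re) (h : IsMonicOrthogonal b Φ κ) (m : ℕ) :
    (b + (m + 1)) * (Φ (m + 1)).coeff 0 = (conj b + m) * (Φ m).coeff 0 := by
  have e0 := congrArg (fun p => coeff p 0) (h.X_sub_one_mul_derivative hb m)
  have e1 := congrArg (fun p => coeff p 1) (h.szego hb m)
  have em := congrArg (fun p => coeff p m) (h.szego hb m)
  have ex := h.coeff_subleading hb m
  -- Writing this coefficient through X Φ_m rather than index m - 1 also covers m = 0, where both
  -- sides vanish.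
  have hr : (recip Φ m).coeff 1 = conj ((X * Φ m).coeff m) := by
    rcases m with _ | m
    · rw [h.coeff_recip_of_lt zero_lt_one]
      simp
    · rw [coeff_recip Φ (by omega), coeff_X_mul]
      rfl
  simp only [coeff_add, coeff_C_mul, hr] at e0 e1 em
  have e1' : (X * Φ m).coeff 1 = (Φ m).coeff 0 := coeff_X_mul _ 0
  rw [coeff_recip_self, ex] at em
  rw [em, e1'] at e1
  rw [sub_mul, one_mul, coeff_sub, coeff_X_mul_derivative, coeff_derivative] at e0
  have hne := h.one_sub_norm_alpha_sq_ne_zero hb m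
  rw [alpha_natCast] at *
  simp only [map_add, map_sub, map_mul, map_neg, conj_conj, map_natCast, map_one] at *
  apply mul_left_cancel₀ hne
  push_cast at e0
  linear_combination e1 - e0

theorem alpha_succ (hb : -1 / 2 < b.re) (h : IsMonicOrthogonal b Φ κ) (m : ℕ) :
    (conj b + (m + 2)) * alpha Φ (m + 1 : ℕ) = (b + (m + 1)) * alpha Φ m := by
  have h1 := congrArg conj (h.coeff_zero_succ hb (m + 1))
  rw [alpha_natCast, alpha_natCast]
  simp only [map_mul, map_add, conj_conj, map_natCast, map_one] at h1
  push_cast at h1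
  linear_combination -h1

/-- The structure relation for the reciprocal polynomials. -/
theorem X_mul_one_sub_X_mul_derivative_recip (hb : -1 / 2 < b.re) (h : IsMonicOrthogonal b Φ κ)
    (m : ℕ) :
    (1 - X) * X * derivative (recip Φ m) =
      C b * (X * recip Φ m) +
        (C ((conj b + (m + 1)) * (alpha Φ m * conj (alpha Φ m))) * recip Φ m +
        C ((conj b + (m + 1)) * alpha Φ m) * Φ (m + 1)) := by
  rw [← sub_eq_zero]
  apply eq_zero_of_pairing_X_pow hb
  intro j hj
  have hlow : 1 ≤ j := by
    by_contra h0
    obtain rfl : j = 0 := by omega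
    refine hj ?_
    rw [mul_assoc]
    simp only [coeff_sub, coeff_add, coeff_C_zero, mul_coeff_zero, coeff_X_zero,
      h.coeff_recip_zero]
    rw [conj_alpha_natCast]
    ring
  have hjm : j ≤ m := by
    by_contra hle
    refine hj ?_
    obtain ⟨i, rfl⟩ : ∃ i, j = i + 1 := ⟨j - 1, by omega⟩
    have hmi : m ≤ i := by omega
    have e : (1 - X) * X * derivative (recip Φ m) =
        X * derivative (recip Φ m) - X * (X * derivative (recip Φ m)) := by ring
    rw [e]
    simp only [coeff_sub, coeff_add, coeff_C_mul, coeff_X_mul, coeff_X_mul_derivative,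
      coeff_derivative]
    rw [h.coeff_recip_of_lt (Nat.lt_succ_of_le hmi)]
    rcases hmi.eq_or_lt with rfl | hlt
    · rw [coeff_recip_self, h.coeff_self, alpha_natCast]
      -- The leading coefficient, at X^{m+1}, cancels exactly by the Verblunsky recursion.
      have h1 := congrArg conj (h.coeff_zero_succ hb m)
      simp only [map_mul, map_add, conj_conj, map_natCast, map_one] at h1
      linear_combination h1
    · rw [h.coeff_recip_of_lt hlt, h.coeff_eq_zero (Nat.succ_lt_succ hlt)]
      ring
  have hd := pairing_derivative hb (recip Φ m) j
  rw [pairing_sub_left hb, pairing_add_left hb, pairing_C_mul_left, pairing_C_mul_left,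
    h.pairing_recip_X_pow hb hlow hjm] at hd
  rw [pairing_sub_left hb, pairing_add_left hb, pairing_add_left hb, pairing_C_mul_left,
    pairing_C_mul_left, pairing_C_mul_left, h.pairing_recip_X_pow hb hlow hjm,
    h.pairing_X_pow hb (Nat.lt_succ_of_le hjm)]
  -- Pearson produces b + 1 - j where the claim has b. The discrepancy vanishes for j = 1, and
  -- otherwise Φ*_m is orthogonal to X^{j-1}.
  have hx : (1 - (j : ℂ)) * pairing b (X * recip Φ m) (X ^ j) = 0 := by
    rcases hlow.eq_or_lt with rfl | hlt
    · simp
    · obtain ⟨i, rfl⟩ : ∃ i, j = i + 1 := ⟨j - 1, by omega⟩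
      rw [pairing_X_mul_X_pow_succ, h.pairing_recip_X_pow hb (by omega) (by omega), mul_zero]
  linear_combination hd + hx

/-- The structure relation for the orthogonal polynomials. -/
theorem X_mul_one_sub_X_mul_derivative (hb : -1 / 2 < b.re) (h : IsMonicOrthogonal b Φ κ)
    (m : ℕ) :
    (1 - X) * X * derivative (Φ (m + 1)) =
      C (-(m + 1 : ℂ)) * (X * Φ (m + 1)) +
        (C ((conj b + (m + 1)) * (1 - alpha Φ m * conj (alpha Φ m))) * Φ (m + 1) +
        C ((conj b + (m + 1)) * (1 - alpha Φ m * conj (alpha Φ m)) * conj (alpha Φ m)) *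
          recip Φ m) := by
  have h1 := h.X_sub_one_mul_derivative hb m
  have h2 := h.szego hb m
  simp only [C_mul, C_neg] at h1 ⊢
  -- The lowering relation is multiplied by -X and X Φ_m is then eliminated by the Szegő recursion.
  linear_combination (-X) * h1 + C (conj b + (m + 1)) * C (1 - alpha Φ m * conj (alpha Φ m)) * h2

end IsMonicOrthogonal

/-! ### Cauchy transforms and their derivatives -/

theorem sub_ne_zero_of_norm_ne_one {z t : ℂ} (hz : ‖z‖ ≠ 1) (ht : t ∈ Metric.sphere (0 : ℂ) 1) :
    t - z ≠ 0 := by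
  rw [sub_ne_zero]
  rintro rfl
  exact hz (by simpa using ht)

theorem hasDerivAt_circleFunctional_div {b : ℂ} (hb : -1 / 2 < b.re) {f : ℂ → ℂ}
    (hf : ContinuousOn f (Metric.sphere 0 1)) {z : ℂ} (hz : ‖z‖ ≠ 1) :
    HasDerivAt (fun w => circleFunctional b (fun t => f t / (t - w)))
      (circleFunctional b (fun t => f t / (t - z) ^ 2)) z := by
  -- Half the distance from z to the circle: on the ball of this radius 1/(t-w)² is at most 1/δ²,
  -- which supplies the dominating function.
  set δ : ℝ := |1 - ‖z‖| / 2 with hδ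
  have hδ0 : 0 < δ := half_pos (abs_pos.mpr (sub_ne_zero.mpr hz.symm))
  have hball : ∀ w ∈ Metric.ball z δ, ∀ t ∈ Metric.sphere (0 : ℂ) 1, δ ≤ ‖t - w‖ := by
    intro w hw t ht
    have h1 : ‖t‖ = 1 := by simpa using ht
    have h2 : ‖w - z‖ < δ := by simpa [dist_eq_norm] using hw
    have h3 : |1 - ‖z‖| ≤ ‖t - z‖ := h1 ▸ abs_norm_sub_norm_le t z
    have h4 : ‖t - z‖ ≤ ‖t - w‖ + ‖w - z‖ := by
      simpa using norm_add_le (t - w) (w - z)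
    have h5 : |1 - ‖z‖| = 2 * δ := by rw [hδ]; ring
    linarith
  have hne : ∀ w ∈ Metric.ball z δ, ∀ t ∈ Metric.sphere (0 : ℂ) 1, t - w ≠ 0 := fun w hw t ht =>
    norm_pos_iff.mp (hδ0.trans_le (hball w hw t ht))
  have hzm : z ∈ Metric.ball z δ := Metric.mem_ball_self hδ0
  have hc1 : ∀ w ∈ Metric.ball z δ,
      ContinuousOn (fun t => f t / (t - w)) (Metric.sphere 0 1) := fun w hw =>
    hf.div (by fun_prop) (hne w hw)
  have hc2 : ContinuousOn (fun t => f t / (t - z) ^ 2) (Metric.sphere 0 1) :=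
    hf.div (by fun_prop) fun t ht => pow_ne_zero 2 (hne z hzm t ht)
  obtain ⟨K, hK⟩ := (isCompact_sphere (0 : ℂ) 1).exists_bound_of_continuousOn hf
  have := intervalIntegral.hasDerivAt_integral_of_dominated_loc_of_deriv_le
    (μ := MeasureTheory.volume) (a := 0) (b := 2 * Real.pi) (x₀ := z) (s := Metric.ball z δ)
    (F := fun w θ => f (circleMap 0 1 θ) / (circleMap 0 1 θ - w) * density b θ)
    (F' := fun w θ => f (circleMap 0 1 θ) / (circleMap 0 1 θ - w) ^ 2 * density b θ)
    (bound := fun θ => K / δ ^ 2 * ‖density b θ‖) (Metric.ball_mem_nhds z hδ0) ?_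
    (intervalIntegrable_mul_density hb (hc1 z hzm)) ?_ ?_ ?_ ?_
  · exact this.2
  · filter_upwards [Metric.ball_mem_nhds z hδ0] with w hw
    rw [Set.uIoc_of_le Real.two_pi_pos.le]
    exact (intervalIntegrable_mul_density hb (hc1 w hw)).1.aestronglyMeasurable
  · rw [Set.uIoc_of_le Real.two_pi_pos.le]
    exact (intervalIntegrable_mul_density hb hc2).1.aestronglyMeasurable
  · refine Filter.Eventually.of_forall fun θ _ w hw => ?_
    have ht := circleMap_mem_sphere_zero_one θ
    rw [norm_mul, norm_div, norm_pow, norm_real]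
    have hw' := hball w hw _ ht
    have hK' := hK _ ht
    have : 0 ≤ K := (norm_nonneg _).trans hK'
    gcongr
  · exact ((intervalIntegrable_density hb).norm).const_mul _
  · refine Filter.Eventually.of_forall fun θ _ w hw => ?_
    have ht := circleMap_mem_sphere_zero_one θ
    have h1 := hne w hw _ ht
    have h2 := (((hasDerivAt_id w).const_sub (circleMap 0 1 θ)).fun_inv h1).const_mul
      (f (circleMap 0 1 θ))
    refine (h2.mul_const (density b θ : ℂ)).congr_deriv ?_
    simp only [id]
    field_simp

/-- The unnormalized Cauchy transform of `p(t) t^{-m}` with respect to `dμ`. -/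
def cauchy (b : ℂ) (m : ℕ) (p : ℂ[X]) (z : ℂ) : ℂ :=
  circleFunctional b (fun t => p.eval t * (t ^ m)⁻¹ / (t - z))

theorem continuousOn_eval_mul_inv_pow (p : ℂ[X]) (m : ℕ) :
    ContinuousOn (fun t => p.eval t * (t ^ m)⁻¹) (Metric.sphere (0 : ℂ) 1) :=
  p.continuous.continuousOn.mul ((continuous_pow m).continuousOn.inv₀ fun z hz =>
    pow_ne_zero m (ne_zero_of_mem_unit_sphere ⟨z, hz⟩))

/-- Since ν dt = i t dμ, the denominator t^{m+1} becomes t^m. G_{m+1} and G*_m share this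
denominator, so both are transforms of the same index m. -/
theorem circleIntegral_cauchy (b : ℂ) (m : ℕ) (p : ℂ[X]) (z : ℂ) :
    (2 * Real.pi * I)⁻¹ * (∮ t in C(0, 1), p.eval t / (t - z) * (nu b t / t ^ (m + 1))) =
      (2 * Real.pi : ℂ)⁻¹ * cauchy b m p z := by
  have h : ∀ t : ℂ, p.eval t / (t - z) * (nu b t / t ^ (m + 1)) =
      p.eval t / (t - z) / t ^ (m + 1) * nu b t := fun t => by ring
  simp only [h]
  rw [circleIntegral_nu b (fun t => p.eval t / (t - z) / t ^ (m + 1)), cauchy, mul_inv, mul_assoc,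
    inv_mul_cancel_left₀ I_ne_zero]
  congr 1
  apply circleFunctional_congr
  intro t ht
  have t0 : t ≠ 0 := ne_zero_of_mem_unit_sphere ⟨t, ht⟩
  rw [pow_succ]
  field_simp

theorem G_succ_eq (b : ℂ) (Φ : ℕ → ℂ[X]) (m : ℕ) (z : ℂ) :
    G b Φ (m + 1) z = (2 * Real.pi : ℂ)⁻¹ * cauchy b m (Φ (m + 1)) z :=
  circleIntegral_cauchy b m _ z

theorem Gstar_eq (b : ℂ) (Φ : ℕ → ℂ[X]) (m : ℕ) (z : ℂ) :
    Gstar b Φ m z = (2 * Real.pi : ℂ)⁻¹ * cauchy b m (recip Φ m) z :=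
  circleIntegral_cauchy b m _ z

section Cauchy

variable {b : ℂ} {m : ℕ} {z : ℂ}

theorem continuousOn_cauchy_integrand (p : ℂ[X]) (m : ℕ) (hz : ‖z‖ ≠ 1) :
    ContinuousOn (fun t => p.eval t * (t ^ m)⁻¹ / (t - z)) (Metric.sphere (0 : ℂ) 1) :=
  (continuousOn_eval_mul_inv_pow p m).div (by fun_prop) fun _ => sub_ne_zero_of_norm_ne_one hz

theorem hasDerivAt_cauchy (hb : -1 / 2 < b.re) (p : ℂ[X]) (hz : ‖z‖ ≠ 1) :
    HasDerivAt (cauchy b m p)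
      (circleFunctional b (fun t => p.eval t * (t ^ m)⁻¹ / (t - z) ^ 2)) z :=
  hasDerivAt_circleFunctional_div hb (continuousOn_eval_mul_inv_pow p m) hz

theorem cauchy_add (hb : -1 / 2 < b.re) (hz : ‖z‖ ≠ 1) (p q : ℂ[X]) :
    cauchy b m (p + q) z = cauchy b m p z + cauchy b m q z := by
  simp only [cauchy, eval_add, add_mul, add_div]
  exact circleFunctional_add hb (continuousOn_cauchy_integrand p m hz)
    (continuousOn_cauchy_integrand q m hz)

theorem cauchy_C_mul (c : ℂ) (p : ℂ[X]) : cauchy b m (C c * p) z = c * cauchy b m p z := by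
  simp only [cauchy, eval_mul, eval_C, mul_assoc, mul_div_assoc]
  exact circleFunctional_const_mul b c _

theorem pairing_X_pow_eq (p : ℂ[X]) (m : ℕ) :
    pairing b p (X ^ m) = circleFunctional b (fun t => p.eval t * (t ^ m)⁻¹) := by
  rw [pairing_eq_circleFunctional]
  apply circleFunctional_congr
  intro t ht
  simp only [eval_pow, eval_X, map_pow, conj_eq_inv_of_mem_sphere ht, inv_pow]

theorem cauchy_X_mul (hb : -1 / 2 < b.re) (hz : ‖z‖ ≠ 1) (p : ℂ[X]) :
    cauchy b m (X * p) z = z * cauchy b m p z + pairing b p (X ^ m) := by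
  rw [pairing_X_pow_eq, cauchy, cauchy, ← circleFunctional_const_mul,
    ← circleFunctional_add hb ((continuousOn_cauchy_integrand p m hz).const_mul z)
      (continuousOn_eval_mul_inv_pow p m)]
  apply circleFunctional_congr
  intro t ht
  have h1 := sub_ne_zero_of_norm_ne_one hz ht
  simp only [eval_mul, eval_X]
  field_simp
  ring

/-- The derivative of the Cauchy transform, after integration by parts. -/
theorem mul_deriv_cauchy (hb : -1 / 2 < b.re) (hz : ‖z‖ ≠ 1) (p : ℂ[X]) :
    z * (1 - z) * deriv (cauchy b m p) z =
      cauchy b m ((1 - X) * X * derivative p) z +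
        ((m + 1 - b) * z - (m + 1 + conj b)) * cauchy b m p z +
          (m - b) * pairing b p (X ^ m) := by
  have hibp := circleFunctional_deriv_eq_zero hb
    (g := fun t => p.eval t * (t ^ m)⁻¹ * (t - z)⁻¹)
    (g' := fun t => ((derivative p).eval t * (t ^ m)⁻¹ +
      p.eval t * (-(m * t ^ (m - 1)) / (t ^ m) ^ 2)) * (t - z)⁻¹ +
        p.eval t * (t ^ m)⁻¹ * (-1 / (t - z) ^ 2)) ?_ ?_
  · rw [(hasDerivAt_cauchy hb p hz).deriv]
    set q : ℂ[X] := (1 - X) * X * derivative p +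
      (C (m + 1 - b - 2) * (X * p) + C (-(m + conj b)) * p) with hq
    -- This comes from t(1-t) = z(1-z) - (2z-1)(t-z) - (t-z)² in the double-pole term; the
    -- polynomial `q` collects the simple-pole terms.
    have e : circleFunctional b (fun t => p.eval t * (t ^ m)⁻¹ / (t - z) ^ 2) * (z * (1 - z)) =
        cauchy b m q z + ((2 * z - 1) * cauchy b m p z + pairing b p (X ^ m)) := by
      have c1 := continuousOn_cauchy_integrand q m hz
      have c2 := (continuousOn_cauchy_integrand p m hz).const_mul (2 * z - 1)
      have c3 := continuousOn_eval_mul_inv_pow p m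
      have c4 : ContinuousOn (fun t => p.eval t * (t ^ m)⁻¹ / (t - z) ^ 2)
          (Metric.sphere (0 : ℂ) 1) :=
        c3.div (by fun_prop) fun t ht => pow_ne_zero 2 (sub_ne_zero_of_norm_ne_one hz ht)
      rw [pairing_X_pow_eq, cauchy, cauchy, ← circleFunctional_const_mul b (2 * z - 1),
        ← circleFunctional_add hb c2 c3, ← circleFunctional_add hb c1 (c2.fun_add c3), ← sub_eq_zero,
        mul_comm, sub_eq_add_neg, ← neg_one_mul, ← circleFunctional_const_mul,
        ← circleFunctional_const_mul,
        ← circleFunctional_add hb (c4.const_mul _) ((c1.fun_add (c2.fun_add c3)).const_mul _),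
        ← mul_zero (-1 : ℂ), ← hibp, ← circleFunctional_const_mul]
      apply circleFunctional_congr
      intro t ht
      have t0 : t ≠ 0 := ne_zero_of_mem_unit_sphere ⟨t, ht⟩
      have t1 := sub_ne_zero_of_norm_ne_one hz ht
      simp only [hq, eval_sub, eval_add, eval_mul, eval_one, eval_C, eval_X]
      rcases m with _ | m
      · simp only [pow_zero, Nat.cast_zero]
        field_simp
        ring
      · simp only [add_tsub_cancel_right]
        push_cast
        field_simp
        ring
    rw [hq, cauchy_add hb hz, cauchy_add hb hz, cauchy_C_mul, cauchy_C_mul,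
      cauchy_X_mul hb hz] at e
    linear_combination e
  · intro t ht
    have t0 : t ≠ 0 := ne_zero_of_mem_unit_sphere ⟨t, ht⟩
    exact ((p.hasDerivAt t).mul ((hasDerivAt_pow m t).fun_inv (pow_ne_zero m t0))).mul
      (((hasDerivAt_id t).sub_const z).fun_inv (sub_ne_zero_of_norm_ne_one hz ht))
  · intro t ht
    have t0 : t ≠ 0 := ne_zero_of_mem_unit_sphere ⟨t, ht⟩
    have h1 : t ^ m ≠ 0 := pow_ne_zero m t0
    have h2 : (t ^ m) ^ 2 ≠ 0 := pow_ne_zero 2 h1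
    have h3 := sub_ne_zero_of_norm_ne_one hz ht
    have h4 : (t - z) ^ 2 ≠ 0 := pow_ne_zero 2 h3
    have c1 := p.continuous.continuousAt (x := t)
    have c2 := (derivative p).continuous.continuousAt (x := t)
    apply ContinuousAt.continuousWithinAt
    fun_prop (disch := assumption)

theorem pairing_conjReflect_right (p : ℂ[X]) {r : ℂ[X]} (hr : r.natDegree ≤ m) :
    pairing b p (conjReflect m r) =
      circleFunctional b (fun t => p.eval t * r.eval t * (t ^ m)⁻¹) := by
  rw [pairing_eq_circleFunctional]
  apply circleFunctional_congr
  intro t ht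
  rw [eval_conjReflect hr ht, map_mul, conj_conj, map_pow, conj_eq_inv_of_mem_sphere ht, inv_pow]
  ring

/-- The divided difference (r(t) - r(z))/(t - z) is a polynomial of degree at most m, so times
t^{-m} it is the conjugate of a reversed polynomial on the circle. -/
theorem cauchy_mul_sub (hb : -1 / 2 < b.re) (hz : ‖z‖ ≠ 1) (p : ℂ[X]) {r : ℂ[X]}
    (hr : r.natDegree ≤ m + 1) :
    cauchy b m (p * r) z - r.eval z * cauchy b m p z =
      pairing b p (conjReflect m (r /ₘ (X - C z))) := by
  have hd : (r /ₘ (X - C z)).natDegree ≤ m := by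
    rw [natDegree_divByMonic r (monic_X_sub_C z), natDegree_X_sub_C]
    omega
  have hdiv := modByMonic_add_div r (X - C z)
  rw [modByMonic_X_sub_C_eq_C_eval] at hdiv
  rw [pairing_conjReflect_right p hd, cauchy, cauchy, sub_eq_add_neg, ← neg_mul,
    ← circleFunctional_const_mul, ← circleFunctional_add hb
      (continuousOn_cauchy_integrand (p * r) m hz)
      ((continuousOn_cauchy_integrand p m hz).const_mul _)]
  apply circleFunctional_congr
  intro t ht
  have t1 := sub_ne_zero_of_norm_ne_one hz ht
  have t0 : t ≠ 0 := ne_zero_of_mem_unit_sphere ⟨t, ht⟩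
  have ht := congrArg (fun q => eval t q) hdiv
  simp only [eval_add, eval_mul, eval_sub, eval_X, eval_C] at ht
  simp only [eval_mul, ← ht]
  field_simp
  ring

end Cauchy

/-! ### Determinant and differential relations for the Cauchy transforms -/

namespace IsMonicOrthogonal

variable {b : ℂ} {Φ : ℕ → ℂ[X]} {κ : ℕ → ℝ}

/-- The Wronskian-type identity behind `det Y = 1`. -/
theorem eval_mul_cauchy_sub (hb : -1 / 2 < b.re) (h : IsMonicOrthogonal b Φ κ) (m : ℕ) {z : ℂ}
    (hz : ‖z‖ ≠ 1) :
    (Φ (m + 1)).eval z * cauchy b m (recip Φ m) z -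
      (recip Φ m).eval z * cauchy b m (Φ (m + 1)) z = -pairing b (Φ m) (Φ m) := by
  have hrd : (recip Φ m).natDegree ≤ m + 1 :=
    natDegree_le_iff_coeff_eq_zero.mpr fun j hj => h.coeff_recip_of_lt (by omega)
  -- The divided-difference formula is used with the two polynomials in either role; subtracting
  -- cancels the transform of their product.
  have h1 := cauchy_mul_sub hb hz (recip Φ m) (h.natDegree_eq (m + 1)).le
  have h2 := cauchy_mul_sub hb hz (Φ (m + 1)) hrd
  have z1 : pairing b (Φ (m + 1)) (conjReflect m (recip Φ m /ₘ (X - C z))) = 0 :=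
    (h.isOrthogonalMonic hb (m + 1)).pairing_eq_zero hb fun j hj =>
      coeff_conjReflect_of_lt (by
        rw [natDegree_divByMonic _ (monic_X_sub_C z), natDegree_X_sub_C]
        omega) hj
  set S := Φ (m + 1) /ₘ (X - C z) with hS
  have hSd : S.natDegree = m := by
    rw [hS, natDegree_divByMonic _ (monic_X_sub_C z), natDegree_X_sub_C, h.natDegree_eq]
    rfl
  have hSm : S.coeff m = 1 := by
    rw [← hSd, coeff_natDegree, hS, leadingCoeff_divByMonic_X_sub_C _ _ z]
    · exact h.monic (m + 1)
    · rw [degree_eq_natDegree (h.monic _).ne_zero, h.natDegree_eq]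
      exact_mod_cast Nat.succ_ne_zero m
  -- The quotient is monic of degree m, so its reversal has constant term 1, and Φ*_m sees only that
  -- term.
  have z2 : pairing b (recip Φ m) (conjReflect m S - X ^ 0) = 0 := by
    apply pairing_eq_zero_of_coeff hb
    intro j hj
    have hj0 : j ≠ 0 := by
      rintro rfl
      exact hj (by simp [coeff_conjReflect S (Nat.zero_le m), hSm])
    have hjm : j ≤ m := by
      by_contra hlt
      refine hj ?_
      rw [coeff_sub, coeff_conjReflect_of_lt hSd.le (by omega), coeff_X_pow, if_neg hj0, sub_zero]
    exact h.pairing_recip_X_pow hb (by omega) hjm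
  rw [pairing_sub_right hb, h.pairing_recip_one hb] at z2
  rw [z1, mul_comm (Φ (m + 1))] at h2
  linear_combination h2 - h1 - z2

theorem mul_deriv_cauchy_poly (hb : -1 / 2 < b.re) (h : IsMonicOrthogonal b Φ κ) (m : ℕ) {z : ℂ}
    (hz : ‖z‖ ≠ 1) :
    z * (1 - z) * deriv (cauchy b m (Φ (m + 1))) z =
      (-b * z - (conj b + (m + 1)) * (alpha Φ m * conj (alpha Φ m))) *
          cauchy b m (Φ (m + 1)) z +
        (conj b + (m + 1)) * (1 - alpha Φ m * conj (alpha Φ m)) * conj (alpha Φ m) *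
          cauchy b m (recip Φ m) z := by
  rw [mul_deriv_cauchy hb hz, h.X_mul_one_sub_X_mul_derivative hb, cauchy_add hb hz,
    cauchy_add hb hz, cauchy_C_mul, cauchy_C_mul, cauchy_C_mul, cauchy_X_mul hb hz,
    h.pairing_X_pow hb (Nat.lt_succ_self m)]
  ring

theorem mul_deriv_cauchy_recip (hb : -1 / 2 < b.re) (h : IsMonicOrthogonal b Φ κ) (m : ℕ) {z : ℂ}
    (hz : ‖z‖ ≠ 1) :
    z * (1 - z) * deriv (cauchy b m (recip Φ m)) z =
      ((m + 1) * z - (conj b + (m + 1)) * (1 - alpha Φ m * conj (alpha Φ m))) *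
          cauchy b m (recip Φ m) z +
        (conj b + (m + 1)) * alpha Φ m * cauchy b m (Φ (m + 1)) z := by
  -- The residual pairing terms b and m - b add up to m; for m = 0 the pairing itself is nonzero but
  -- its factor is not.
  have h0 : (m : ℂ) * pairing b (recip Φ m) (X ^ m) = 0 := by
    rcases m with _ | m
    · simp
    · rw [h.pairing_recip_X_pow hb (by omega) le_rfl, mul_zero]
  rw [mul_deriv_cauchy hb hz, h.X_mul_one_sub_X_mul_derivative_recip hb, cauchy_add hb hz,
    cauchy_add hb hz, cauchy_C_mul, cauchy_C_mul, cauchy_C_mul, cauchy_X_mul hb hz]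
  linear_combination h0

end IsMonicOrthogonal

/-! ### Logarithmic derivatives of the branches -/

/-- Differentiating f² = g determines the logarithmic derivative of any differentiable square root,
so the choice of branch never enters. -/
theorem hasDerivAt_of_sq_eventuallyEq {f g : ℂ → ℂ} {z l : ℂ} (hf : DifferentiableAt ℂ f z)
    (hfg : (fun w => f w ^ 2) =ᶠ[nhds z] g) (hg : HasDerivAt g (g z * l) z) (h0 : f z ≠ 0) :
    HasDerivAt f (f z * (l / 2)) z := by
  have h1 := (hf.hasDerivAt.fun_pow 2).unique (hg.congr_of_eventuallyEq hfg)
  have h2 : f z ^ 2 = g z := hfg.eq_of_nhds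
  refine hf.hasDerivAt.congr_deriv ?_
  rw [← h2] at h1
  apply mul_left_cancel₀ h0
  norm_num at h1
  linear_combination h1 / 2

theorem hasDerivAt_of_exp_eventuallyEq {f g : ℂ → ℂ} {z g' : ℂ} (hf : DifferentiableAt ℂ f z)
    (hfg : (fun w => exp (f w)) =ᶠ[nhds z] g) (hg : HasDerivAt g g' z) :
    HasDerivAt f (g' / g z) z := by
  have h1 := hf.hasDerivAt.cexp.unique (hg.congr_of_eventuallyEq hfg)
  have h2 : exp (f z) = g z := hfg.eq_of_nhds
  refine hf.hasDerivAt.congr_deriv ?_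
  rw [← h1, ← h2, mul_div_cancel_left₀ _ (exp_ne_zero _)]

theorem fin_two_of_congr {a b c d a' b' c' d' : ℂ} (ha : a = a') (hb : b = b') (hc : c = c')
    (hd : d = d') : !![a, b; c, d] = !![a', b'; c', d'] := by
  rw [ha, hb, hc, hd]

namespace Branch

variable {b : ℂ} {n : ℕ} {U : Set ℂ} (β : Branch b n U) {z : ℂ}

theorem ne_zero (β : Branch b n U) (hz : z ∈ U) : z ≠ 0 :=
  neg_ne_zero.mp (β.exp_logNeg z hz ▸ exp_ne_zero _)

theorem one_sub_ne_zero (β : Branch b n U) (hz : z ∈ U) : 1 - z ≠ 0 :=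
  β.exp_logOneSub z hz ▸ exp_ne_zero _

theorem sqrtNu_ne_zero (hz : z ∈ U) : β.sqrtNu z ≠ 0 := fun h => by
  have := β.sqrtNu_sq z hz
  rw [h, zero_pow two_ne_zero] at this
  exact exp_ne_zero _ this.symm

theorem powHalf_ne_zero (hz : z ∈ U) : β.powHalf z ≠ 0 := fun h => by
  have := β.powHalf_sq z hz
  rw [h, zero_pow two_ne_zero] at this
  exact pow_ne_zero n (β.ne_zero hz) this.symm

theorem hasDerivAt_sqrtNu (hU : IsOpen U) (hz : z ∈ U) :
    HasDerivAt β.sqrtNu (β.sqrtNu z * ((-conj b / z - (b + conj b) / (1 - z)) / 2)) z := by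
  have hmem := hU.mem_nhds hz
  have z0 := β.ne_zero hz
  have d1 : HasDerivAt β.logNeg (-1 / -z) z :=
    hasDerivAt_of_exp_eventuallyEq (β.logNeg_holo.differentiableAt hmem)
      (Filter.eventuallyEq_of_mem hmem β.exp_logNeg) (hasDerivAt_neg z)
  have d2 : HasDerivAt β.logOneSub (-1 / (1 - z)) z :=
    hasDerivAt_of_exp_eventuallyEq (β.logOneSub_holo.differentiableAt hmem)
      (Filter.eventuallyEq_of_mem hmem β.exp_logOneSub) ((hasDerivAt_id z).const_sub 1)
  refine hasDerivAt_of_sq_eventuallyEq (β.sqrtNu_holo.differentiableAt hmem)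
    (Filter.eventuallyEq_of_mem hmem β.sqrtNu_sq) ?_ (β.sqrtNu_ne_zero hz)
  refine ((d1.const_mul (-conj b)).add (d2.const_mul (b + conj b))).cexp.congr_deriv ?_
  have z1 := β.one_sub_ne_zero hz
  simp only [Pi.add_apply]
  congr 1
  field_simp
  ring

theorem hasDerivAt_powHalf (hU : IsOpen U) (hz : z ∈ U) :
    HasDerivAt β.powHalf (β.powHalf z * (n / z / 2)) z := by
  have hmem := hU.mem_nhds hz
  have z0 := β.ne_zero hz
  refine hasDerivAt_of_sq_eventuallyEq (β.powHalf_holo.differentiableAt hmem)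
    (Filter.eventuallyEq_of_mem hmem β.powHalf_sq) ?_ (β.powHalf_ne_zero hz)
  refine (hasDerivAt_pow n z).congr_deriv ?_
  rcases n with _ | n
  · simp
  · simp only [add_tsub_cancel_right]
    field_simp
    ring

/-- Logarithmic derivative of the `(1,1)` entry of `C_n`. -/
theorem hasDerivAt_div (hU : IsOpen U) (hz : z ∈ U) :
    HasDerivAt (fun w => β.sqrtNu w / β.powHalf w)
      (β.sqrtNu z / β.powHalf z *
        ((-conj b / z - (b + conj b) / (1 - z)) / 2 - n / z / 2)) z := by
  have h1 := β.powHalf_ne_zero hz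
  refine ((β.hasDerivAt_sqrtNu hU hz).div (β.hasDerivAt_powHalf hU hz) h1).congr_deriv ?_
  field_simp

/-- Logarithmic derivative of the `(2,2)` entry of `C_n`. -/
theorem hasDerivAt_div_swap (hU : IsOpen U) (hz : z ∈ U) :
    HasDerivAt (fun w => β.powHalf w / β.sqrtNu w)
      (-(β.powHalf z / β.sqrtNu z *
        ((-conj b / z - (b + conj b) / (1 - z)) / 2 - n / z / 2))) z := by
  have h1 := β.sqrtNu_ne_zero hz
  refine ((β.hasDerivAt_powHalf hU hz).div (β.hasDerivAt_sqrtNu hU hz) h1).congr_deriv ?_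
  field_simp
  ring

theorem det_C (hz : z ∈ U) : (β.C z).det = 1 := by
  have h1 := β.sqrtNu_ne_zero hz
  have h2 := β.powHalf_ne_zero hz
  rw [Branch.C, Matrix.det_fin_two_of]
  field_simp
  ring

end Branch

/-! ### The structure matrix -/

namespace IsMonicOrthogonal

variable {b : ℂ} {Φ : ℕ → ℂ[X]} {κ : ℕ → ℝ}

theorem bconst_ne_zero (h : IsMonicOrthogonal b Φ κ) (n : ℕ) : bconst κ n ≠ 0 := by
  have := h.kappa_pos n
  rw [bconst, ofReal_ne_zero]
  positivity

theorem bconst_mul_pairing (h : IsMonicOrthogonal b Φ κ) (n : ℕ) :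
    bconst κ n * pairing b (Φ n) (Φ n) = 2 * Real.pi := by
  have : (κ n : ℂ) ≠ 0 := ofReal_ne_zero.mpr (h.kappa_pos n).ne'
  rw [h.norm_sq, bconst]
  push_cast
  field_simp

/-- Each b_n is 2π over the squared norm of Φ_n, so this is the norm ratio of consecutive
polynomials. -/
theorem inv_bconst_succ (hb : -1 / 2 < b.re) (h : IsMonicOrthogonal b Φ κ) (m : ℕ) :
    (bconst κ (m + 1))⁻¹ * bconst κ m = 1 - alpha Φ m * conj (alpha Φ m) := by
  have h1 := h.bconst_mul_pairing m
  have h2 := h.bconst_mul_pairing (m + 1)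
  rw [h.pairing_self_succ hb, ← h1] at h2
  have h3 := h.bconst_ne_zero (m + 1)
  apply mul_right_cancel₀ (h.pairing_self_ne_zero hb m)
  field_simp
  linear_combination -h2

theorem differentiableAt_and_deriv_G (hb : -1 / 2 < b.re) (h : IsMonicOrthogonal b Φ κ) (m : ℕ) {z : ℂ}
    (hz : ‖z‖ ≠ 1) :
    DifferentiableAt ℂ (G b Φ (m + 1)) z ∧ z * (1 - z) * deriv (G b Φ (m + 1)) z =
      (-b * z - (conj b + (m + 1)) * (alpha Φ m * conj (alpha Φ m))) * G b Φ (m + 1) z +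
        (conj b + (m + 1)) * (1 - alpha Φ m * conj (alpha Φ m)) * conj (alpha Φ m) *
          Gstar b Φ m z := by
  have hd := hasDerivAt_cauchy hb (m := m) (Φ (m + 1)) hz
  have e : G b Φ (m + 1) = fun w => (2 * Real.pi : ℂ)⁻¹ * cauchy b m (Φ (m + 1)) w :=
    funext (G_succ_eq b Φ m)
  rw [Gstar_eq, e]
  refine ⟨hd.differentiableAt.const_mul _, ?_⟩
  rw [deriv_const_mul _ hd.differentiableAt]
  linear_combination (2 * Real.pi : ℂ)⁻¹ * h.mul_deriv_cauchy_poly hb m hz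

theorem differentiableAt_and_deriv_Gstar (hb : -1 / 2 < b.re) (h : IsMonicOrthogonal b Φ κ) (m : ℕ) {z : ℂ}
    (hz : ‖z‖ ≠ 1) :
    DifferentiableAt ℂ (Gstar b Φ m) z ∧ z * (1 - z) * deriv (Gstar b Φ m) z =
      ((m + 1) * z - (conj b + (m + 1)) * (1 - alpha Φ m * conj (alpha Φ m))) * Gstar b Φ m z +
        (conj b + (m + 1)) * alpha Φ m * G b Φ (m + 1) z := by
  have hd := hasDerivAt_cauchy hb (m := m) (recip Φ m) hz
  have e : Gstar b Φ m = fun w => (2 * Real.pi : ℂ)⁻¹ * cauchy b m (recip Φ m) w :=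
    funext (Gstar_eq b Φ m)
  rw [G_succ_eq, e]
  refine ⟨hd.differentiableAt.const_mul _, ?_⟩
  rw [deriv_const_mul _ hd.differentiableAt]
  linear_combination (2 * Real.pi : ℂ)⁻¹ * h.mul_deriv_cauchy_recip hb m hz

theorem det_Y (hb : -1 / 2 < b.re) (h : IsMonicOrthogonal b Φ κ) (m : ℕ) {z : ℂ}
    (hz : ‖z‖ ≠ 1) : (Y b Φ κ (m + 1) z).det = 1 := by
  rw [Y, Matrix.det_fin_two_of, add_tsub_cancel_right, G_succ_eq, Gstar_eq]
  have h1 := h.eval_mul_cauchy_sub hb m hz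
  have h2 := h.bconst_mul_pairing m
  have hpi : (2 * Real.pi : ℂ) ≠ 0 := by exact_mod_cast Real.two_pi_pos.ne'
  have h3 : (2 * Real.pi : ℂ)⁻¹ * (2 * Real.pi) = 1 := inv_mul_cancel₀ hpi
  linear_combination -(bconst κ m) * (2 * Real.pi : ℂ)⁻¹ * h1 + (2 * Real.pi : ℂ)⁻¹ * h2 + h3

theorem eval_derivative (hb : -1 / 2 < b.re) (h : IsMonicOrthogonal b Φ κ) (m : ℕ) (z : ℂ) :
    z * (1 - z) * (derivative (Φ (m + 1))).eval z =
      (-(m + 1) * z + (conj b + (m + 1)) * (1 - alpha Φ m * conj (alpha Φ m))) *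
          (Φ (m + 1)).eval z +
        (conj b + (m + 1)) * (1 - alpha Φ m * conj (alpha Φ m)) * conj (alpha Φ m) *
          (recip Φ m).eval z := by
  have h1 := congrArg (eval z) (h.X_mul_one_sub_X_mul_derivative hb m)
  simp only [eval_mul, eval_add, eval_sub, eval_X, eval_one, eval_C] at h1
  linear_combination h1

theorem eval_derivative_recip (hb : -1 / 2 < b.re) (h : IsMonicOrthogonal b Φ κ) (m : ℕ) (z : ℂ) :
    z * (1 - z) * (derivative (recip Φ m)).eval z =
      (b * z + (conj b + (m + 1)) * (alpha Φ m * conj (alpha Φ m))) * (recip Φ m).eval z +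
        (conj b + (m + 1)) * alpha Φ m * (Φ (m + 1)).eval z := by
  have h1 := congrArg (eval z) (h.X_mul_one_sub_X_mul_derivative_recip hb m)
  simp only [eval_mul, eval_add, eval_sub, eval_X, eval_one, eval_C] at h1
  linear_combination h1

/-- The structure matrix of the constant jump fundamental matrix. -/
theorem smul_M (hb : -1 / 2 < b.re) (h : IsMonicOrthogonal b Φ κ) (m : ℕ) {U : Set ℂ}
    (hU : IsOpen U) (hUT : ∀ z ∈ U, ‖z‖ ≠ 1) (β : Branch b (m + 1) U) {z : ℂ} (hz : z ∈ U) :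
    (z * (1 - z)) • M β Φ κ z =
      !![-((b + (m + 1)) * z + (conj b + (m + 1)) * (2 * (alpha Φ m * conj (alpha Φ m)) - 1)) / 2,
          -(bconst κ (m + 1))⁻¹ * (conj b + (m + 1)) * conj (alpha Φ m);
         -bconst κ m * (conj b + (m + 1)) * alpha Φ m,
          ((b + (m + 1)) * z +
            (conj b + (m + 1)) * (2 * (alpha Φ m * conj (alpha Φ m)) - 1)) / 2] := by
  have hz1 := hUT z hz
  have hdet : IsUnit (Z β Φ κ z).det := by
    rw [Z, Matrix.det_mul, h.det_Y hb m hz1, β.det_C hz, one_mul]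
    exact isUnit_one
  -- As det Z = 1, it suffices to verify the linear system for Z' and cancel Z on the right.
  suffices hD : (z * (1 - z)) • (Matrix.of fun i j => deriv (fun w => Z β Φ κ w i j) z) =
      !![-((b + (m + 1)) * z + (conj b + (m + 1)) * (2 * (alpha Φ m * conj (alpha Φ m)) - 1)) / 2,
          -(bconst κ (m + 1))⁻¹ * (conj b + (m + 1)) * conj (alpha Φ m);
         -bconst κ m * (conj b + (m + 1)) * alpha Φ m,
          ((b + (m + 1)) * z +
            (conj b + (m + 1)) * (2 * (alpha Φ m * conj (alpha Φ m)) - 1)) / 2] * Z β Φ κ z by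
    rw [M, ← smul_mul_assoc, hD, Matrix.mul_nonsing_inv_cancel_right _ _ hdet]
  have z0 := β.ne_zero hz
  have z1 := β.one_sub_ne_zero hz
  have dc := β.hasDerivAt_div hU hz
  have dd := β.hasDerivAt_div_swap hU hz
  set ℓ : ℂ := (-conj b / z - (b + conj b) / (1 - z)) / 2 - (m + 1 : ℕ) / z / 2 with hℓ
  have eℓ : z * (1 - z) * ℓ = (-(conj b + (m + 1)) + (m + 1 - b) * z) / 2 := by
    rw [hℓ]
    push_cast
    field_simp
    ring
  obtain ⟨gd, ge⟩ := h.differentiableAt_and_deriv_G hb m hz1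
  obtain ⟨sd, se⟩ := h.differentiableAt_and_deriv_Gstar hb m hz1
  have pe := h.eval_derivative hb m z
  have re := h.eval_derivative_recip hb m z
  -- It turns the b_m/b_{m+1} produced by the off-diagonal entry into the 1 - |α_m|² of the scalar
  -- relations in the first row.
  have hk := h.inv_bconst_succ hb m
  have d00 : deriv (fun w => Z β Φ κ w 0 0) z =
      (derivative (Φ (m + 1))).eval z * (β.sqrtNu z / β.powHalf z) +
        (Φ (m + 1)).eval z * (β.sqrtNu z / β.powHalf z * ℓ) := by
    simp only [Z, Y, Branch.C, Matrix.mul_fin_two, Matrix.of_apply, Matrix.cons_val', mul_zero,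
      Matrix.cons_val_zero, add_zero]
    exact (((Φ (m + 1)).hasDerivAt z).mul dc).deriv
  have d01 : deriv (fun w => Z β Φ κ w 0 1) z =
      deriv (G b Φ (m + 1)) z * (β.powHalf z / β.sqrtNu z) +
        G b Φ (m + 1) z * -(β.powHalf z / β.sqrtNu z * ℓ) := by
    simp only [Z, Y, Branch.C, Matrix.mul_fin_two, Matrix.of_apply, Matrix.cons_val', mul_zero,
      Matrix.cons_val_zero, Matrix.cons_val_one, zero_add]
    exact (gd.hasDerivAt.mul dd).deriv
  have d10 : deriv (fun w => Z β Φ κ w 1 0) z =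
      -bconst κ m * (derivative (recip Φ m)).eval z * (β.sqrtNu z / β.powHalf z) +
        -bconst κ m * (recip Φ m).eval z * (β.sqrtNu z / β.powHalf z * ℓ) := by
    simp only [Z, Y, Branch.C, Matrix.mul_fin_two, Matrix.of_apply, Matrix.cons_val', mul_zero,
      Matrix.cons_val_zero, Matrix.cons_val_one, add_zero, add_tsub_cancel_right]
    exact ((((recip Φ m).hasDerivAt z).const_mul _).mul dc).deriv
  have d11 : deriv (fun w => Z β Φ κ w 1 1) z =
      -bconst κ m * deriv (Gstar b Φ m) z * (β.powHalf z / β.sqrtNu z) +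
        -bconst κ m * Gstar b Φ m z * -(β.powHalf z / β.sqrtNu z * ℓ) := by
    simp only [Z, Y, Branch.C, Matrix.mul_fin_two, Matrix.of_apply, Matrix.cons_val', mul_zero,
      Matrix.cons_val_zero, Matrix.cons_val_one, zero_add, add_tsub_cancel_right]
    exact ((sd.hasDerivAt.const_mul _).mul dd).deriv
  rw [Matrix.eta_fin_two (Matrix.of fun i j => deriv (fun w => Z β Φ κ w i j) z)]
  simp only [Matrix.of_apply, d00, d01, d10, d11]
  simp only [Z, Y, Branch.C, Matrix.mul_fin_two, Matrix.smul_of, Matrix.smul_cons, smul_eq_mul,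
    Matrix.smul_empty, mul_zero, add_zero, zero_add, add_tsub_cancel_right]
  generalize β.sqrtNu z / β.powHalf z = c at *
  generalize β.powHalf z / β.sqrtNu z = d at *
  refine fin_two_of_congr ?_ ?_ ?_ ?_
  · linear_combination c * pe + c * (Φ (m + 1)).eval z * eℓ -
      c * (conj b + (m + 1)) * conj (alpha Φ m) * (recip Φ m).eval z * hk
  · linear_combination d * ge - d * G b Φ (m + 1) z * eℓ -
      d * (conj b + (m + 1)) * conj (alpha Φ m) * Gstar b Φ m z * hk
  · linear_combination -bconst κ m * c * re - bconst κ m * c * (recip Φ m).eval z * eℓ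
  · linear_combination -bconst κ m * d * se + bconst κ m * d * Gstar b Φ m z * eℓ

end IsMonicOrthogonal

end JacobiOPUC

end

open JacobiOPUC Polynomial ComplexConjugate in
theorem mainTheorem11 (b : ℂ) (hb : -1 / 2 < b.re) :
    -- the monic orthogonal polynomials exist and are unique
    (∃! P : (ℕ → ℂ[X]) × (ℕ → ℝ), IsMonicOrthogonal b P.1 P.2) ∧
    ∀ (Φ : ℕ → ℂ[X]) (κ : ℕ → ℝ), IsMonicOrthogonal b Φ κ → ∀ n : ℕ, 1 ≤ n →
      -- `Y_n` is holomorphic off the unit circle, with determinant 1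
      DifferentiableOn ℂ (G b Φ n) {z | ‖z‖ ≠ 1} ∧
      DifferentiableOn ℂ (Gstar b Φ (n - 1)) {z | ‖z‖ ≠ 1} ∧
      (∀ z : ℂ, ‖z‖ ≠ 1 → (Y b Φ κ n z).det = 1) ∧
      -- the two representations of `z (1 - z) M_n`, for all local branches
      (∀ U : Set ℂ, IsOpen U → (∀ z ∈ U, ‖z‖ ≠ 1) → ∀ β : Branch b n U, ∀ z ∈ U,
        (z * (1 - z)) • M β Φ κ z =
          !![-((b + n) * z + (conj b + n) * (2 * ‖alpha Φ (n - 1)‖ ^ 2 - 1)) / 2,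
              -(bconst κ n)⁻¹ * (conj b + n) * conj (alpha Φ (n - 1));
             -bconst κ (n - 1) * (conj b + n) * alpha Φ (n - 1),
              ((b + n) * z + (conj b + n) * (2 * ‖alpha Φ (n - 1)‖ ^ 2 - 1)) / 2] ∧
        (z * (1 - z)) • M β Φ κ z =
          !![-((b + n) * z + (conj b - n)) / 2 + (Φ n).coeff (n - 1),
              -(b + n + 1) * (bconst κ n)⁻¹ * conj (alpha Φ n);
             -(b + n - 1) * bconst κ (n - 1) * alpha Φ (n - 2),
              ((b + n) * z + (conj b - n)) / 2 - (Φ n).coeff (n - 1)]) ∧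
      -- the consequences of comparing them
      (Φ n).coeff (n - 1) = conj b - (conj b + n) * ‖alpha Φ (n - 1)‖ ^ 2 ∧
      alpha Φ n = (b + n) / (conj b + n + 1) * alpha Φ (n - 1) ∧
      -- first-order differential relations
      (∀ z : ℂ, z * (1 - z) * (derivative (Φ n)).eval z =
        (-n * z + (conj b + n) * (1 - ‖alpha Φ (n - 1)‖ ^ 2)) * (Φ n).eval z +
          (conj b + n) * (1 - ‖alpha Φ (n - 1)‖ ^ 2) * conj (alpha Φ (n - 1)) *
            (recip Φ (n - 1)).eval z) ∧
      (∀ z : ℂ, ‖z‖ ≠ 1 → z * (1 - z) * deriv (G b Φ n) z =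
        (-b * z - (conj b + n) * ‖alpha Φ (n - 1)‖ ^ 2) * G b Φ n z +
          (conj b + n) * (1 - ‖alpha Φ (n - 1)‖ ^ 2) * conj (alpha Φ (n - 1)) *
            Gstar b Φ (n - 1) z) ∧
      (∀ z : ℂ, z * (1 - z) * (derivative (recip Φ (n - 1))).eval z =
        (b * z + (conj b + n) * ‖alpha Φ (n - 1)‖ ^ 2) * (recip Φ (n - 1)).eval z +
          (conj b + n) * alpha Φ (n - 1) * (Φ n).eval z) ∧
      (∀ z : ℂ, ‖z‖ ≠ 1 → z * (1 - z) * deriv (Gstar b Φ (n - 1)) z =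
        (n * z - (conj b + n) * (1 - ‖alpha Φ (n - 1)‖ ^ 2)) * Gstar b Φ (n - 1) z +
          (conj b + n) * alpha Φ (n - 1) * G b Φ n z) ∧
      (∀ z : ℂ, (z - 1) * (derivative (Φ n)).eval z =
        -(conj b + n) * (1 - ‖alpha Φ (n - 1)‖ ^ 2) * (Φ (n - 1)).eval z +
          n * (Φ n).eval z) := by
  refine ⟨existsUnique_isMonicOrthogonal hb, fun Φ κ h n hn => ?_⟩
  obtain ⟨m, rfl⟩ : ∃ m, n = m + 1 := ⟨n - 1, by omega⟩
  have i1 : ((m + 1 : ℕ) : ℤ) - 1 = m := by push_cast; ring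
  -- The index n - 2 is an integer and is -1 when m = 0, so α_{n-2} is expressed through Φ_m(0),
  -- which covers α_{-1} as well.
  have i2 : alpha Φ (((m + 1 : ℕ) : ℤ) - 2) = -conj ((Φ m).coeff 0) := by
    rw [alpha, coeff_zero_eq_eval_zero]
    congr 4
    omega
  have c1 : ((m + 1 : ℕ) : ℂ) = m + 1 := by push_cast; ring
  -- Its real part exceeds m + 3/2.
  have hne : conj b + (m + 2) ≠ 0 := fun h0 => by
    have h1 := congrArg Complex.re h0
    simp at h1
    have h2 : (0 : ℝ) ≤ m := Nat.cast_nonneg m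
    linarith
  have hα := h.alpha_succ hb m
  have hα' : (b + (m + 2)) * conj (alpha Φ (m + 1 : ℕ)) =
      (conj b + (m + 1)) * conj (alpha Φ m) := by
    simpa [Complex.conj_ofNat] using congrArg conj hα
  have hx := h.coeff_subleading hb m
  have hM : ∀ U : Set ℂ, IsOpen U → (∀ z ∈ U, ‖z‖ ≠ 1) → ∀ β : Branch b (m + 1) U, ∀ z ∈ U, _ :=
    fun U hU hUT β z hz => h.smul_M hb m hU hUT β hz
  rw [i1, i2, c1, add_tsub_cancel_right, norm_alpha_sq]
  refine ⟨fun z hz => (h.differentiableAt_and_deriv_G hb m hz).1.differentiableWithinAt,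
    fun z hz => (h.differentiableAt_and_deriv_Gstar hb m hz).1.differentiableWithinAt,
    fun z hz => h.det_Y hb m hz, fun U hU hUT β z hz => ⟨hM U hU hUT β z hz, ?_⟩, hx, ?_,
    h.eval_derivative hb m, fun z hz => (h.differentiableAt_and_deriv_G hb m hz).2, h.eval_derivative_recip hb m,
    fun z hz => (h.differentiableAt_and_deriv_Gstar hb m hz).2, fun z => ?_⟩
  · rw [hM U hU hUT β z hz]
    -- The recursion for constant coefficients is used here instead of `alpha_succ`, since it also
    -- includes the step from α_{-1} to α_0.
    have h3 := congrArg conj (h.coeff_zero_succ hb m)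
    simp only [map_mul, map_add, Complex.conj_conj, map_natCast, map_one] at h3
    refine fin_two_of_congr ?_ ?_ ?_ ?_
    · rw [hx]
      ring
    · linear_combination (bconst κ (m + 1))⁻¹ * hα'
    · rw [alpha_natCast]
      linear_combination bconst κ m * h3
    · rw [hx]
      ring
  · rw [div_mul_eq_mul_div, eq_div_iff (by convert hne using 1; ring)]
    linear_combination hα
  · have h1 := congrArg (eval z) (h.X_sub_one_mul_derivative hb m)
    simp only [eval_mul, eval_add, eval_sub, eval_X, eval_one, eval_C] at h1
    linear_combination h1
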